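/- **The lace expansion for site percolation.** Let $d\ge 1$ and $p\in[0,1]$, and let $\mathbb P_p$ be the product measure on $\{0,1\}^{\mathbb Z^d}$ under which each site is occupied with probability $p$, independently of the others; a configuration $\omega$ is identified with its set of occupied sites, and $|\cdot|$ is the $1$-norm on $\mathbb Z^d$. *Connections.* For $u\neq x$ and $A\subseteq\mathbb Z^d$, $\{u\leftrightarrow x \text{ in } A\}$ is the event that there is a nearest-neighbour path from $u$ to $x$ all of whose inner vertices lie in $\omega\cap A$ (no condition on the end points); for $u=x$ it is empty. Write $\{u\leftrightarrow x\}$ for $A=\mathbb Z^d$ and $\{u\leftrightarrow x\text{ off }A\}=\{u\leftrightarrow x\text{ in }\mathbb Z^d\setminus A\}$. Put $\tau_p(x)=\mathbb P_p(0\leftrightarrow x)$, $J(x)=\mathbf 1_{\{|x|=1\}}$, $\mathscr C(0)=\{0\}\cup\{y\in\omega:0\leftrightarrow y\}$, $\theta(p)=\mathbb P_p(|\mathscr C(0)|=\infty)$ and $p_c=\inf\{p>0:\theta(p)>0\}$. Let $(f*g)(x)=\sum_{y\in\mathbb Z^d} f(y)g(x-y)$. *Events.* Let $\{u\Leftrightarrow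 x\}=\{u\leftrightarrow x\}\circ\{u\leftrightarrow x\}$, where $A\circ B$ is the set of $\omega$ for which there are disjoint $K,L\subseteq\mathbb Z^d$ such that every configuration agreeing with $\omega$ on $K$ lies in $A$ and every configuration agreeing with $\omega$ on $L$ lies in $B$. Let $\langle A\rangle$ be $A$ together with all neighbours of its points, and $$\widetilde{\mathscr C}^{u}(x)=\{x\}\cup\{y\in\omega\setminus\{u\}: x\leftrightarrow y\text{ in }\mathbb Z^d\setminus\{u\}\},$$ $$\{u\xrightarrow{A}x\}=\{u\leftrightarrow x\}\cap\big(\{u\leftrightarrow x\text{ off }\langle A\rangle\}^c\cup\{x\in\langle A\rangle\}\big).$$ Let $\mathrm{Piv}(v,u)$ be the set of $y$ such that $\{v\leftrightarrow u\}$ holds for $\omega\cup\{y\}$ but not for $\omega\setminus\{y\}$, and $$E'(v,u;A)=\{v\xrightarrow{A}u\}\cap\{\nexists\,u'\in\mathrm{Piv}(v,u): v\xrightarrow{A}u'\}.$$ *Coefficients.* Let $\omega_0,\omega_1,\dots$ be independent configurations with law $\mathbb P_p$; a subscript $i$ on an event means that it takes place on $\omega_i$. Given sites $u_0,u_1,\dots$,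 put $u_{-1}=0$ and $\mathscr C_i=\widetilde{\mathscr C}^{u_i}(u_{i-1};\omega_i)$. Let $\Pi^{(0)}_p(x)=\mathbb P_p(0\Leftrightarrow x)-J(x)$ and, for $m\ge1$ (with $u_m=x$) and $n\ge0$, $$\Pi^{(m)}_p(x)=p^m\sum_{u_0,\dots,u_{m-1}}\mathbb P_p\Big(\{0\Leftrightarrow u_0\}_0\cap\bigcap_{i=1}^m E'(u_{i-1},u_i;\mathscr C_{i-1})_i\Big),$$ $$R_{p,n}(x)=(-p)^{n+1}\sum_{u_0,\dots,u_n}\mathbb P_p\Big(\{0\Leftrightarrow u_0\}_0\cap\bigcap_{i=1}^n E'(u_{i-1},u_i;\mathscr C_{i-1})_i\cap\{u_n\xrightarrow{\mathscr C_n}x\}_{n+1}\Big),$$ $$\Pi_{p,n}(x)=\sum_{m=0}^n(-1)^m\Pi_p^{(m)}(x).$$ *Claim.* Let $p<p_c$, $x\in\mathbb Z^d$ and $n\ge0$. Then the series defining $\Pi^{(m)}_p(y)$ for $1\le m\le n$ and $y\in\mathbb Z^d$, the series defining $R_{p,n}(x)$, and the series $\big((J+\Pi_{p,n})*\tau_p\big)(x)$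 converge absolutely, and $$\tau_p(x)=J(x)+\Pi_{p,n}(x)+p\big((J+\Pi_{p,n})*\tau_p\big)(x)+R_{p,n}(x).$$ -/

import Mathlib

open MeasureTheory ProbabilityTheory

noncomputable section

namespace SitePercolation

/-- The sites of the hypercubic lattice `ℤ^d`. -/
abbrev Site (d : ℕ) := Fin d → ℤ

/-- A configuration, identified with its set of occupied sites. The `σ`-algebra on `Set (Site d)`
is the one generated by the coordinates `ω ↦ (x ∈ ω)`, that is, by the cylinder sets. -/
abbrev Config (d : ℕ) := Set (Site d)

variable {d : ℕ}

/-- The `1`-norm on `ℤ^d`. -/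
def norm1 (x : Site d) : ℤ := ∑ i, |x i|

/-- `ℙ_p`: every site is occupied with probability `p`, independently of all others. -/
def perc (d : ℕ) (p : unitInterval) : Measure (Config d) :=
  setBernoulli (Set.univ : Set (Site d)) p

instance (d : ℕ) (p : unitInterval) : IsProbabilityMeasure (perc d p) := by
  unfold perc; infer_instance

/-- The law of a sequence `(ω_i)_{i ∈ ℕ}` of independent percolation configurations. -/
def percSeq (d : ℕ) (p : unitInterval) : Measure (ℕ → Config d) :=
  Measure.infinitePi fun _ : ℕ => perc d p

/-- `u` and `x` are distinct, and some nearest-neighbour path from `u` to `x` has all its inner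
vertices in `S` (no condition on the end points). -/
def Joined (S : Set (Site d)) (u x : Site d) : Prop :=
  u ≠ x ∧ ∃ (k : ℕ) (v : ℕ → Site d), v 0 = u ∧ v k = x ∧
    (∀ i < k, norm1 (v (i + 1) - v i) = 1) ∧ ∀ i, 0 < i → i < k → v i ∈ S

/-- The event `{u ⟷ x}`. -/
def conn (u x : Site d) : Set (Config d) := {ω | Joined ω u x}

/-- The event `{u ⟷ x in A}`. -/
def connIn (A : Set (Site d)) (u x : Site d) : Set (Config d) := {ω | Joined (ω ∩ A) u x}

/-- The event `{u ⟷ x off A}`. -/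
def connOff (A : Set (Site d)) (u x : Site d) : Set (Config d) := connIn Aᶜ u x

/-- The cluster `𝒞(x)` of `x` in `ω`. -/
def cluster (ω : Config d) (x : Site d) : Set (Site d) := {x} ∪ {y | y ∈ ω ∧ ω ∈ conn x y}

/-- The two-point function `τ_p(x) = ℙ_p(0 ⟷ x)`. -/
def tau (p : unitInterval) (x : Site d) : ℝ := (perc d p).real (conn 0 x)

/-- The percolation probability `θ(p) = ℙ_p(|𝒞(0)| = ∞)`. -/
def theta (d : ℕ) (p : unitInterval) : ℝ :=
  (perc d p).real {ω | (cluster ω (0 : Site d)).Infinite}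

/-- The critical point `p_c = inf {p > 0 : θ(p) > 0}`, where `p` ranges over `[0,1]`. -/
def pc (d : ℕ) : ℝ := sInf {q : ℝ | ∃ p : unitInterval, (p : ℝ) = q ∧ 0 < q ∧ 0 < theta d p}

/-- `J(x) = 𝟙{|x| = 1}`. -/
def J (x : Site d) : ℝ := if norm1 x = 1 then 1 else 0

/-- Convolution of functions on `ℤ^d`. -/
def conv (f g : Site d → ℝ) (x : Site d) : ℝ := ∑' y, f y * g (x - y)

/-- The cylinder event `[ω]_K` of the configurations that agree with `ω` on `K`. -/
def cyl (ω : Config d) (K : Set (Site d)) : Set (Config d) := {ω' | ∀ y ∈ K, y ∈ ω' ↔ y ∈ ω}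

/-- The disjoint occurrence `A ∘ B`. -/
def disjointOcc (A B : Set (Config d)) : Set (Config d) :=
  {ω | ∃ K L : Set (Site d), K ∩ L = ∅ ∧ cyl ω K ⊆ A ∧ cyl ω L ⊆ B}

/-- The event `{u ⟺ x}` that `u` and `x` are doubly connected. -/
def doubleConn (u x : Site d) : Set (Config d) := disjointOcc (conn u x) (conn u x)

/-- The modified cluster `𝒞̃^u(x)` of `x` with designated vertex `u`. -/
def modCluster (u x : Site d) (ω : Config d) : Set (Site d) :=
  {x} ∪ {y | y ∈ ω \ {u} ∧ ω ∈ connIn {u}ᶜ x y}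

/-- `⟨A⟩`: the set `A` together with its external boundary. -/
def thick (A : Set (Site d)) : Set (Site d) := A ∪ {y | ∃ x ∈ A, norm1 (x - y) = 1}

/-- The event that `u` is connected to `x` through `A`: they are connected and, in addition,
they are not connected off `⟨A⟩` or `x ∈ ⟨A⟩`. -/
def throughConn (A : Set (Site d)) (u x : Site d) : Set (Config d) :=
  conn u x ∩ ((connOff (thick A) u x)ᶜ ∪ {_ω | x ∈ thick A})

/-- The pivotal points of an event `A` in the configuration `ω`. -/
def piv (A : Set (Config d)) (ω : Config d) : Set (Site d) :=
  {y | ω ∪ {y} ∈ A ∧ ω \ {y} ∉ A}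

/-- The event `E'(v,u;A)`. -/
def E' (v u : Site d) (A : Set (Site d)) : Set (Config d) :=
  throughConn A v u ∩ {ω | ¬ ∃ u' ∈ piv (conn v u) ω, ω ∈ throughConn A v u'}

/-- The sequence `u_{-1} = 0, u_0, …, u_{m-1}, u_m = x`, shifted by one: the value at `k` is
`u_{k-1}`. -/
def vertexSeq {m : ℕ} (u : Fin m → Site d) (x : Site d) : ℕ → Site d
  | 0 => 0
  | k + 1 => if h : k < m then u ⟨k, h⟩ else x

/-- The event `{u_{-1} ⟺ u_0}_0 ∩ ⋂_{i=1}^m E'(u_{i-1}, u_i; 𝒞_{i-1})_i` with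
`𝒞_i = 𝒞̃^{u_i}(u_{i-1}; ω_i)`, where `v k = u_{k-1}`. The variable `i` below is the `i - 1` of
this formula. -/
def laceEvent (m : ℕ) (v : ℕ → Site d) : Set (ℕ → Config d) :=
  {ω | ω 0 ∈ doubleConn (v 0) (v 1) ∧
    ∀ i < m, ω (i + 1) ∈ E' (v (i + 1)) (v (i + 2)) (modCluster (v (i + 1)) (v i) (ω i))}

/-- The event `laceEvent n v` intersected with the event that `u_n` is connected to `u_{n+1}`
through `𝒞_n` in `ω_{n+1}`, where `v k = u_{k-1}`. -/
def remainderEvent (n : ℕ) (v : ℕ → Site d) : Set (ℕ → Config d) :=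
  laceEvent n v ∩
    {ω | ω (n + 1) ∈ throughConn (modCluster (v (n + 1)) (v n) (ω n)) (v (n + 1)) (v (n + 2))}

/-- The lace-expansion coefficients `Π_p^{(m)}`. -/
def PiCoeff (p : unitInterval) : ℕ → Site d → ℝ
  | 0, x => (perc d p).real (doubleConn 0 x) - J x
  | m + 1, x => (p : ℝ) ^ (m + 1) *
      ∑' u : Fin (m + 1) → Site d, (percSeq d p).real (laceEvent (m + 1) (vertexSeq u x))

/-- `Π_{p,n} = ∑_{m=0}^n (-1)^m Π_p^{(m)}`. -/
def PiSum (p : unitInterval) (n : ℕ) (x : Site d) : ℝ :=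
  ∑ m ∈ Finset.range (n + 1), (-1) ^ m * PiCoeff p m x

/-- The remainder `R_{p,n}`. -/
def remainder (p : unitInterval) (n : ℕ) (x : Site d) : ℝ :=
  (-(p : ℝ)) ^ (n + 1) *
    ∑' u : Fin (n + 1) → Site d, (percSeq d p).real (remainderEvent n (vertexSeq u x))

end SitePercolation

end

noncomputable section

namespace SitePercolation

variable {d : ℕ}

/-! ### Adjacency and reachability -/

/-- Nearest neighbours of `ℤ^d`. -/
def Adj (a b : Site d) : Prop := norm1 (b - a) = 1

lemma norm1_neg (x : Site d) : norm1 (-x) = norm1 x := by simp [norm1]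

lemma norm1_sub_comm (x y : Site d) : norm1 (x - y) = norm1 (y - x) := by
  rw [← norm1_neg, neg_sub]

lemma Adj.symm {a b : Site d} (h : Adj a b) : Adj b a := by
  unfold Adj at *; rwa [norm1_sub_comm]

lemma Adj.ne {a b : Site d} (h : Adj a b) : a ≠ b := by
  rintro rfl
  simp [Adj, norm1] at h

/-- `y` is reached from `u` by a nearest-neighbour path all of whose vertices, except possibly the
first one, lie in `S`. -/
def Reach (S : Set (Site d)) (u y : Site d) : Prop :=
  Relation.ReflTransGen (fun a b => Adj a b ∧ b ∈ S) u y

variable {S T : Set (Site d)} {u v w x y z : Site d}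

lemma Reach.refl (S : Set (Site d)) (u : Site d) : Reach S u u := Relation.ReflTransGen.refl

lemma Reach.tail (h : Reach S u y) (hyz : Adj y z) (hz : z ∈ S) : Reach S u z :=
  Relation.ReflTransGen.tail h ⟨hyz, hz⟩

lemma Reach.trans (h : Reach S u y) (h' : Reach S y z) : Reach S u z :=
  Relation.ReflTransGen.trans h h'

@[elab_as_elim]
lemma Reach.rec_tail {motive : Site d → Prop} (h : Reach S u y) (base : motive u)
    (step : ∀ b c, Reach S u b → Adj b c → c ∈ S → motive b → motive c) : motive y := by
  induction h with
  | refl => exact base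
  | tail hab hbc ih => exact step _ _ hab hbc.1 hbc.2 ih

lemma Reach.mono (hST : S ⊆ T) (h : Reach S u y) : Reach T u y := by
  refine h.rec_tail (.refl _ _) fun b c _ hbc hc ih => ih.tail hbc (hST hc)

lemma Reach.eq_or_mem (h : Reach S u y) : y = u ∨ y ∈ S :=
  h.rec_tail (.inl rfl) fun _ _ _ _ hc _ => .inr hc

lemma Reach.first_hit (T : Set (Site d)) (h : Reach S u y) :
    Reach (S \ T) u y ∨ ∃ z t, Reach (S \ T) u z ∧ Adj z t ∧ t ∈ T ∧ t ∈ S := by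
  refine h.rec_tail (.inl (.refl _ _)) fun b c _ hbc hc ih => ?_
  rcases ih with ih | ih
  · by_cases hT : c ∈ T
    · exact .inr ⟨b, c, ih, hbc, hT, hc⟩
    · exact .inl (ih.tail hbc ⟨hc, hT⟩)
  · exact .inr ih

lemma Reach.last_exit (T : Set (Site d)) (h : Reach S u y) :
    Reach (S \ T) u y ∨ ∃ t ∈ T, t ∈ S ∧ Reach S u t ∧ Reach (S \ T) t y := by
  refine h.rec_tail (.inl (.refl _ _)) fun b c hb hbc hc ih => ?_
  by_cases hT : c ∈ T
  · exact .inr ⟨c, hT, hc, hb.tail hbc hc, .refl _ _⟩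
  · rcases ih with ih | ⟨t, ht, htS, h1, h2⟩
    · exact .inl (ih.tail hbc ⟨hc, hT⟩)
    · exact .inr ⟨t, ht, htS, h1, h2.tail hbc ⟨hc, hT⟩⟩

lemma Reach.sdiff_left (h : Reach S u y) : Reach (S \ {u}) u y := by
  rcases h.last_exit {u} with h | ⟨t, rfl, -, -, h⟩ <;> exact h

/-- Every vertex of the set of vertices of `S` reached from `u` is reached within that set. -/
lemma Reach.within (h : Reach S u y) : Reach {z | z ∈ S ∧ Reach S u z} u y :=
  h.rec_tail (.refl _ _) fun _ _ hb hbc hc ih => ih.tail hbc ⟨hc, hb.tail hbc hc⟩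

lemma joined_iff : Joined S u x ↔ u ≠ x ∧ ∃ y, Reach S u y ∧ Adj y x := by
  refine and_congr_right fun hux => ⟨?_, ?_⟩
  · rintro ⟨k, v, h0, hk, hadj, hS⟩
    have hreach : ∀ i, i < k → Reach S u (v i) := by
      intro i
      induction i with
      | zero => intro _; rw [h0]; exact .refl _ _
      | succ i ih =>
        intro hi
        exact (ih (by omega)).tail (hadj i (by omega)) (hS _ (by omega) hi)
    rcases k with _ | k
    · exact absurd (h0.symm.trans hk) hux
    · exact ⟨v k, hreach k (by omega), hk ▸ hadj k (by omega)⟩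
  · rintro ⟨y, hy, hyx⟩
    have : ∃ (k : ℕ) (v : ℕ → Site d), v 0 = u ∧ v k = y ∧
        (∀ i < k, norm1 (v (i + 1) - v i) = 1) ∧ ∀ i, 0 < i → i ≤ k → v i ∈ S := by
      refine hy.rec_tail ⟨0, fun _ => u, rfl, rfl, by simp, by intro i; omega⟩ ?_
      rintro b c - hbc hc ⟨k, v, h0, hk, hadj, hS⟩
      refine ⟨k + 1, fun i => if i ≤ k then v i else c, by simp [h0], by simp, ?_, ?_⟩
      · intro i hi
        rcases Nat.lt_succ_iff_lt_or_eq.1 hi with h | rfl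
        · simpa [h.le, Nat.succ_le_of_lt h] using hadj i h
        · simpa [hk, Adj] using hbc
      · intro i hi hik
        by_cases h : i ≤ k
        · simpa [h] using hS i hi h
        · simpa [h] using hc
    obtain ⟨k, v, h0, hk, hadj, hS⟩ := this
    refine ⟨k + 1, fun i => if i ≤ k then v i else x, by simp [h0], by simp, ?_, ?_⟩
    · intro i hi
      rcases Nat.lt_succ_iff_lt_or_eq.1 hi with h | rfl
      · simpa [h.le, Nat.succ_le_of_lt h] using hadj i h
      · simpa [hk, Adj] using hyx
    · intro i hi hik
      simpa [Nat.lt_succ_iff.1 hik] using hS i hi (Nat.lt_succ_iff.1 hik)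

lemma Reach.joined_of_adj (h : Reach S u y) (hyx : Adj y x) (hux : u ≠ x) : Joined S u x :=
  joined_iff.2 ⟨hux, y, h, hyx⟩

lemma Joined.mono (hST : S ⊆ T) (h : Joined S u x) : Joined T u x := by
  obtain ⟨hux, y, hy, hyx⟩ := joined_iff.1 h
  exact (hy.mono hST).joined_of_adj hyx hux

lemma Joined.reach (h : Joined S u x) (hx : x ∈ S) : Reach S u x := by
  obtain ⟨hux, y, hy, hyx⟩ := joined_iff.1 h
  exact hy.tail hyx hx

lemma Reach.joined (h : Reach S u x) (hux : u ≠ x) : Joined S u x := by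
  rcases Relation.ReflTransGen.cases_tail h with rfl | ⟨c, hc, hcx⟩
  · exact absurd rfl hux
  · exact Reach.joined_of_adj hc hcx.1 hux

lemma Reach.trans_joined (h : Reach S u y) (h' : Joined S y x) (hux : u ≠ x) : Joined S u x := by
  obtain ⟨-, z, hz, hzx⟩ := joined_iff.1 h'
  exact (h.trans hz).joined_of_adj hzx hux

lemma Joined.first_hit (T : Set (Site d)) (h : Joined S u x) :
    Joined (S \ T) u x ∨ ∃ z t, Reach (S \ T) u z ∧ Adj z t ∧ t ∈ T ∧ t ∈ S := by
  obtain ⟨hux, y, hy, hyx⟩ := joined_iff.1 h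
  exact (hy.first_hit T).imp_left fun h => h.joined_of_adj hyx hux

lemma Joined.sdiff_left (h : Joined S u x) : Joined (S \ {u}) u x := by
  obtain ⟨hux, y, hy, hyx⟩ := joined_iff.1 h
  exact hy.sdiff_left.joined_of_adj hyx hux

lemma Joined.sdiff_right (h : Joined S u x) : Joined (S \ {x}) u x := by
  rcases h.first_hit {x} with h' | ⟨z, t, hz, hzt, rfl, -⟩
  · exact h'
  · exact hz.joined_of_adj hzt h.1

lemma Reach.reverse (h : Reach S u y) (hyx : Adj y x) : ∃ z, Reach S x z ∧ Adj z u := by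
  suffices H : ∀ x, Adj y x → ∃ z, Reach S x z ∧ Adj z u from H x hyx
  refine h.rec_tail (fun x hx => ⟨x, .refl _ _, hx.symm⟩) ?_
  intro b c _ hbc hc ih x hcx
  obtain ⟨z, hz, hzu⟩ := ih c hbc
  exact ⟨z, (Reach.refl S x |>.tail hcx.symm hc).trans hz, hzu⟩

lemma Joined.symm (h : Joined S u x) : Joined S x u := by
  obtain ⟨hux, y, hy, hyx⟩ := joined_iff.1 h
  obtain ⟨z, hz, hzu⟩ := hy.reverse hyx
  exact hz.joined_of_adj hzu hux.symm

/-- A vertex that separates `u` from `x` is joined to both. -/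
lemma Joined.of_cut (h : Joined S u x) (hy : ¬ Joined (S \ {y}) u x) :
    y ∈ S ∧ Joined (S \ {y}) u y ∧ Joined (S \ {y}) y x := by
  have hyu : u ≠ y := by rintro rfl; exact hy h.sdiff_left
  have hyx : y ≠ x := by rintro rfl; exact hy h.sdiff_right
  obtain ⟨hux, w, hw, hwx⟩ := joined_iff.1 h
  refine ⟨?_, ?_, ?_⟩
  · rcases h.first_hit {y} with h' | ⟨z, t, hz, hzt, rfl, ht⟩
    · exact absurd h' hy
    · exact ht
  · rcases h.first_hit {y} with h' | ⟨z, t, hz, hzt, rfl, ht⟩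
    · exact absurd h' hy
    · exact hz.joined_of_adj hzt hyu
  · rcases hw.last_exit {y} with h' | ⟨t, rfl, -, -, h'⟩
    · exact absurd (h'.joined_of_adj hwx hux) hy
    · exact h'.joined_of_adj hwx hyx

/-- Of two vertices that separate `v` from `x`, one separates `v` from the other. -/
lemma Joined.cut_total (h : Joined S v x) (hy : ¬ Joined (S \ {y}) v x)
    (hz : ¬ Joined (S \ {z}) v x) (hyz : y ≠ z) :
    ¬ Joined (S \ {y}) v z ∨ ¬ Joined (S \ {z}) v y := by
  by_contra! hcon
  obtain ⟨hvx, w, hw, hwx⟩ := joined_iff.1 h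
  rcases hw.last_exit {y, z} with h' | ⟨t, ht, htS, -, h'⟩
  · exact hy ((h'.joined_of_adj hwx hvx).mono (by
      intro a ha; exact ⟨ha.1, fun h => ha.2 (.inl h)⟩))
  · rcases ht with rfl | rfl
    · refine hz (((hcon.2.reach ⟨htS, hyz⟩).trans (h'.mono ?_)).joined_of_adj hwx hvx)
      intro a ha; exact ⟨ha.1, fun h => ha.2 (.inr h)⟩
    · refine hy (((hcon.1.reach ⟨htS, hyz.symm⟩).trans (h'.mono ?_)).joined_of_adj hwx hvx)
      intro a ha; exact ⟨ha.1, fun h => ha.2 (.inl h)⟩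

/-- Among a nonempty set of vertices separating `v` from `x` there is a first one. -/
lemma Joined.exists_first_cut (h : Joined S v x) (P : Set (Site d))
    (hP : ∀ y ∈ P, ¬ Joined (S \ {y}) v x) (hne : P.Nonempty) :
    ∃ y ∈ P, ∀ z ∈ P, Joined (S \ {z}) v y := by
  have hsub : ∀ z ∈ P, S \ P ⊆ S \ {z} := fun z hz a ha => ⟨ha.1, fun h => ha.2 (h ▸ hz)⟩
  rcases h.first_hit P with h' | ⟨z, t, hz, hzt, htP, -⟩
  · obtain ⟨y, hy⟩ := hne
    exact absurd (h'.mono (hsub y hy)) (hP y hy)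
  · refine ⟨t, htP, fun y hy => (hz.joined_of_adj hzt (h.of_cut (hP t htP)).2.1.1).mono (hsub y hy)⟩

/-! ### The two-path case of the theorem of Menger -/

/-- There are two vertex-disjoint paths in `S` from `v` to `w`. -/
def TwoPaths (S : Set (Site d)) (v w : Site d) : Prop :=
  ∃ K L : Set (Site d), K ∩ L = ∅ ∧ K ⊆ S \ {w} ∧ L ⊆ S \ {w} ∧ Joined K v w ∧ Joined L v w

lemma Joined.exists_reached_subset (h : Joined S u x) :
    ∃ K ⊆ S, (∀ z ∈ K, Reach K u z) ∧ Joined K u x := by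
  obtain ⟨hux, y, hy, hyx⟩ := joined_iff.1 h
  exact ⟨{z | z ∈ S ∧ Reach S u z}, fun z hz => hz.1, fun z hz => hz.2.within,
    hy.within.joined_of_adj hyx hux⟩

lemma TwoPaths.step (h : TwoPaths S v w) (hw : w ∈ S) (hww : Adj w z)
    (hj : Joined (S \ {w}) v z) : TwoPaths S v z := by
  obtain ⟨K₀, L₀, hKL₀, hK₀, hL₀, hjK₀, hjL₀⟩ := h
  obtain ⟨K, hKK, hK, hjK⟩ := hjK₀.exists_reached_subset
  obtain ⟨L, hLL, hL, hjL⟩ := hjL₀.exists_reached_subset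
  have hdisj : ∀ a, a ∈ K → a ∈ L → False := fun a ha hb => by
    have : a ∈ K₀ ∩ L₀ := ⟨hKK ha, hLL hb⟩
    simp [hKL₀] at this
  have hKS : ∀ a ∈ K, a ∈ S ∧ a ≠ w := fun a ha => hK₀ (hKK ha)
  have hLS : ∀ a ∈ L, a ∈ S ∧ a ≠ w := fun a ha => hL₀ (hLL ha)
  have hvz : v ≠ z := hj.1
  obtain ⟨-, q, hq, hqz⟩ := joined_iff.1 hj
  -- a path leaving `K`, together with the path in `L` prolonged by `w`
  have glue : ∀ K L : Set (Site d), (∀ a, a ∈ K → a ∈ L → False) → (∀ a ∈ K, a ∈ S ∧ a ≠ w) →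
      (∀ a ∈ L, a ∈ S ∧ a ≠ w) → Joined L v w → ∀ t, Reach K v t →
      Reach ((S \ {w}) \ (K ∪ L)) t q → TwoPaths S v z := by
    intro K L hKL hK hL hjL t ht htq
    refine ⟨(K ∪ ((S \ {w}) \ (K ∪ L))) \ {z}, (L ∪ {w}) \ {z}, ?_, ?_, ?_, ?_, ?_⟩
    · ext a
      simp only [Set.mem_inter_iff, Set.mem_sdiff, Set.mem_union, Set.mem_singleton_iff,
        Set.mem_empty_iff_false, iff_false]
      have := hKL a
      have := hK a
      tauto
    · rintro a ⟨ha | ha, haz⟩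
      · exact ⟨(hK a ha).1, haz⟩
      · exact ⟨ha.1.1, haz⟩
    · rintro a ⟨ha | rfl, haz⟩
      · exact ⟨(hL a ha).1, haz⟩
      · exact ⟨hw, haz⟩
    · exact (((ht.mono Set.subset_union_left).trans
        (htq.mono Set.subset_union_right)).joined_of_adj hqz hvz).sdiff_right
    · exact (((hjL.mono Set.subset_union_left).reach (by simp)).joined_of_adj hww hvz).sdiff_right
  rcases hq.last_exit (K ∪ L) with h' | ⟨t, ht | ht, -, -, h'⟩
  · exact glue K L hdisj hKS hLS hjL v (.refl _ _) h'
  · exact glue K L hdisj hKS hLS hjL t (hK t ht) h'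
  · exact glue L K (fun a h1 h2 => hdisj a h2 h1) hLS hKS hjK t (hL t ht)
      (by rwa [Set.union_comm] at h')

lemma twoPaths_of_adj (h : Adj v w) : TwoPaths S v w :=
  ⟨∅, ∅, by simp, by simp, by simp, (Reach.refl _ _).joined_of_adj h h.ne,
    (Reach.refl _ _).joined_of_adj h h.ne⟩

/-- If no vertex separates `v` from `u` in `S`, there are two disjoint paths in `S`. -/
lemma twoPaths_of_no_cut (hj : Joined S v u) (h : ∀ y, Joined (S \ {y}) v u) :
    ∃ K L : Set (Site d), K ∩ L = ∅ ∧ K ⊆ S ∧ L ⊆ S ∧ Joined K v u ∧ Joined L v u := by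
  set S' : Set (Site d) := (S ∪ {u}) \ {v} with hS'
  suffices H : TwoPaths S' v u by
    obtain ⟨K, L, hKL, hK, hL, h1, h2⟩ := H
    refine ⟨K, L, hKL, fun a ha => ?_, fun a ha => ?_, h1, h2⟩
    · obtain ⟨⟨ha | ha, -⟩, h3⟩ := hK ha
      exacts [ha, absurd ha h3]
    · obtain ⟨⟨ha | ha, -⟩, h3⟩ := hL ha
      exacts [ha, absurd ha h3]
  have hvu : v ≠ u := hj.1
  have huS : u ∈ S' := ⟨.inr rfl, hvu.symm⟩
  have key : ∀ y, y ≠ u → Reach (S' \ {y}) v u := fun y hy =>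
    (Joined.mono (T := S' \ {y}) (fun a ha => ⟨⟨.inl ha.1.1, ha.2⟩, ha.1.2⟩)
      (h y).sdiff_left).reach ⟨huS, hy.symm⟩
  by_contra hcon
  have hru : Reach S' v u :=
    (Joined.mono (T := S') (fun a ha => ⟨.inl ha.1, ha.2⟩) hj.sdiff_left).reach huS
  rcases hru.last_exit {w | TwoPaths S' v w} with h' | ⟨t, ht, htS, -, h'⟩
  · obtain h' | ⟨c, hc, -⟩ := Relation.ReflTransGen.cases_head h'
    · exact hvu h'
    · exact hc.2.2 (twoPaths_of_adj hc.1)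
  · have htu : t ≠ u := by rintro rfl; exact hcon ht
    obtain h'' | ⟨c, hc, hcu⟩ := Relation.ReflTransGen.cases_head h'
    · exact htu h''
    · refine hc.2.2 (TwoPaths.step ht htS hc.1 ?_)
      have hcv : v ≠ c := fun h => hc.2.1.2 h.symm
      have hcu' : Reach (S' \ {t}) c u :=
        Reach.mono (fun a ha => ⟨ha.1, fun h => ha.2 (by rw [h]; exact ht)⟩) hcu
      by_cases hcu2 : c = u
      · rw [hcu2]; exact (key t htu).joined hvu
      · have := (hcu'.joined hcu2).symm
        exact (key t htu).trans_joined this hcv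

/-! ### Pivotal points, double connections and the cutting-point decomposition -/

variable {ω ω' : Config d} {A C : Set (Site d)}

lemma mem_piv_conn (h : ω ∈ conn v x) : y ∈ piv (conn v x) ω ↔ ¬ Joined (ω \ {y}) v x :=
  ⟨fun hy => hy.2, fun hy => ⟨Joined.mono Set.subset_union_left h, hy⟩⟩

lemma throughConn_univ (u x : Site d) : throughConn Set.univ u x = conn u x := by
  ext ω; simp [throughConn, thick]

lemma doubleConn_eq_E' (v u : Site d) : doubleConn v u = E' v u Set.univ := by
  ext ω
  simp only [E', throughConn_univ]
  constructor
  · rintro ⟨K, L, hKL, hK, hL⟩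
    have hc : ω ∈ conn v u := hK fun y _ => Iff.rfl
    refine ⟨hc, ?_⟩
    rintro ⟨y, hy, -⟩
    have hmem : ∀ M : Set (Site d), y ∉ M → ω \ {y} ∈ cyl ω M := by
      intro M hM z hz
      have : z ≠ y := by rintro rfl; exact hM hz
      simp [this]
    by_cases hyK : y ∈ K
    · have hyL : y ∉ L := fun h => by
        have : y ∈ K ∩ L := ⟨hyK, h⟩
        simp [hKL] at this
      exact hy.2 (hL (hmem L hyL))
    · exact hy.2 (hK (hmem K hyK))
  · rintro ⟨hc, hno⟩
    have hall : ∀ y, Joined (ω \ {y}) v u := by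
      intro y
      by_contra hy
      exact hno ⟨y, (mem_piv_conn hc).2 hy, (Joined.of_cut hc hy).2.1.mono Set.sdiff_subset⟩
    obtain ⟨K, L, hKL, hK, hL, h1, h2⟩ := twoPaths_of_no_cut hc hall
    exact ⟨K, L, hKL, fun ω' h => h1.mono fun a ha => (h a ha).2 (hK ha),
      fun ω' h => h2.mono fun a ha => (h a ha).2 (hL ha)⟩

lemma mem_modCluster : y ∈ modCluster u v ω ↔ Reach (ω \ {u}) v y := by
  simp only [modCluster, connIn, ← Set.sdiff_eq]
  constructor
  · rintro (rfl | ⟨hy, h⟩)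
    · exact .refl _ _
    · exact Joined.reach h hy
  · intro h
    by_cases hy : v = y
    · exact .inl hy.symm
    · exact .inr ⟨h.eq_or_mem.resolve_left (Ne.symm hy), h.joined hy⟩

lemma mem_cluster : y ∈ cluster ω v ↔ Reach ω v y := by
  constructor
  · rintro (rfl | ⟨hy, h⟩)
    · exact .refl _ _
    · exact Joined.reach h hy
  · intro h
    by_cases hy : v = y
    · exact .inl hy.symm
    · exact .inr ⟨h.eq_or_mem.resolve_left (Ne.symm hy), h.joined hy⟩

lemma mem_thick : y ∈ thick A ↔ y ∈ A ∨ ∃ x ∈ A, Adj x y := by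
  simp only [thick, Adj]
  refine or_congr_right ⟨?_, ?_⟩ <;> rintro ⟨x, hx, h⟩ <;> exact ⟨x, hx, by rwa [norm1_sub_comm]⟩

lemma modCluster_subset_cluster (u v : Site d) (ω : Config d) :
    modCluster u v ω ⊆ cluster ω v := fun _ hy =>
  mem_cluster.2 ((mem_modCluster.1 hy).mono Set.sdiff_subset)

/-- The event that `u` is connected to `x`, but not through `A`. -/
def avoidConn (A : Set (Site d)) (u x : Site d) : Set (Config d) :=
  {ω | ω ∈ connOff (thick A) u x ∧ x ∉ thick A}

lemma avoidConn_eq (A : Set (Site d)) (u x : Site d) :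
    avoidConn A u x = conn u x \ throughConn A u x := by
  ext ω
  have : ω ∈ connOff (thick A) u x → ω ∈ conn u x := fun h => Joined.mono Set.inter_subset_left h
  simp only [avoidConn, throughConn, Set.mem_sdiff, Set.mem_inter_iff, Set.mem_union,
    Set.mem_compl_iff, Set.mem_ofPred_eq]
  tauto

lemma mem_thick_modCluster (hvx : v ≠ x) :
    x ∈ thick (modCluster u v ω) → Joined (ω \ {u}) v x := by
  intro h
  rcases mem_thick.1 h with h | ⟨y, hy, hyx⟩
  · exact (mem_modCluster.1 h).joined hvx
  · exact (mem_modCluster.1 hy).joined_of_adj hyx hvx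

/-- A site `u` connected to `v` is pivotal for the connection from `v` to `x` if and only if it is
occupied and connected to `x` off the modified cluster of `v`. -/
lemma mem_piv_iff_avoidConn (hvu : ω ∈ conn v u) :
    (ω ∈ conn v x ∧ u ∈ piv (conn v x) ω) ↔ (u ∈ ω ∧ ω ∈ avoidConn (modCluster u v ω) u x) := by
  constructor
  · rintro ⟨hvx, hu⟩
    have hu' := (mem_piv_conn hvx).1 hu
    obtain ⟨huω, -, hux⟩ := Joined.of_cut hvx hu'
    have hne : v ≠ x := hvx.1
    refine ⟨huω, ?_, fun h => hu' (mem_thick_modCluster hne h)⟩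
    obtain ⟨hux', y, hy, hyx⟩ := joined_iff.1 hux
    rcases hy.last_exit (thick (modCluster u v ω)) with h | ⟨t, ht, htω, -, h⟩
    · exact (Reach.mono (T := ω ∩ (thick (modCluster u v ω))ᶜ)
        (fun a ha => ⟨ha.1.1, ha.2⟩) h).joined_of_adj hyx hux'
    · exfalso
      refine hu' ?_
      have hr : Reach (ω \ {u}) v t := by
        by_cases hvt : v = t
        · rw [← hvt]; exact .refl _ _
        · exact (mem_thick_modCluster hvt ht).reach htω
      exact (hr.trans (h.mono Set.sdiff_subset)).joined_of_adj hyx hne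
  · rintro ⟨huω, hav, hx⟩
    have hvC : v ∈ modCluster u v ω := mem_modCluster.2 (.refl _ _)
    have hne : v ≠ x := by rintro rfl; exact hx (.inl hvC)
    have hvx : ω ∈ conn v x :=
      (Joined.reach hvu huω).trans_joined (Joined.mono Set.inter_subset_left hav) hne
    refine ⟨hvx, (mem_piv_conn hvx).2 fun hj => hx ?_⟩
    obtain ⟨-, y, hy, hyx⟩ := joined_iff.1 hj
    exact mem_thick.2 (.inr ⟨y, mem_modCluster.2 hy, hyx⟩)

lemma conn_of_E' (h : ω ∈ E' v u A) : ω ∈ conn v u := h.1.1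

lemma throughConn_of_E' (h : ω ∈ E' v u A) (hx : ω ∈ conn v x) (hu : u ∈ piv (conn v x) ω) :
    ω ∈ throughConn A v x := by
  refine ⟨hx, or_iff_not_imp_right.2 fun hxA hoff => ?_⟩
  have hcut : ¬ Joined ((ω ∩ (thick A)ᶜ) \ {u}) v x := fun hj =>
    (mem_piv_conn hx).1 hu (hj.mono (Set.sdiff_subset_sdiff_left Set.inter_subset_left))
  obtain ⟨huA, hvu, -⟩ := Joined.of_cut hoff hcut
  rcases h.1.2 with hoffu | hthick
  · exact hoffu (hvu.mono Set.sdiff_subset)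
  · exact huA.2 hthick

/-- The decomposition according to the first pivotal point to which `v` is connected through `A`. -/
lemma throughConn_iff : ω ∈ throughConn A v x ↔ ω ∈ E' v x A ∨
    ∃ u, ω ∈ E' v u A ∧ u ∈ ω ∧ ω ∈ avoidConn (modCluster u v ω) u x := by
  constructor
  · intro h
    by_cases hE : ω ∈ E' v x A
    · exact .inl hE
    right
    have hvx : ω ∈ conn v x := h.1
    have hne : {u | u ∈ piv (conn v x) ω ∧ ω ∈ throughConn A v u}.Nonempty := by
      by_contra hcon
      rw [Set.not_nonempty_iff_eq_empty] at hcon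
      refine hE ⟨h, ?_⟩
      rintro ⟨u, hu⟩
      have : u ∈ {u | u ∈ piv (conn v x) ω ∧ ω ∈ throughConn A v u} := hu
      simp [hcon] at this
    obtain ⟨u, ⟨hu, huA⟩, hmin⟩ := Joined.exists_first_cut hvx _
      (fun y hy => (mem_piv_conn hvx).1 hy.1) hne
    have hvu : ω ∈ conn v u := huA.1
    refine ⟨u, ⟨huA, ?_⟩, (mem_piv_iff_avoidConn hvu).1 ⟨hvx, hu⟩⟩
    rintro ⟨y, hy, hyA⟩
    have hyu := (mem_piv_conn hvu).1 hy
    refine hyu (hmin y ⟨(mem_piv_conn hvx).2 fun hj => hyu ?_, hyA⟩)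
    have hcut : ¬ Joined ((ω \ {y}) \ {u}) v x := fun hj' =>
      (mem_piv_conn hvx).1 hu (hj'.mono (Set.sdiff_subset_sdiff_left Set.sdiff_subset))
    exact (Joined.of_cut hj hcut).2.1.mono Set.sdiff_subset
  · rintro (h | ⟨u, hu, hu'⟩)
    · exact h.1
    · obtain ⟨hx, hp⟩ := (mem_piv_iff_avoidConn (conn_of_E' hu)).2 hu'
      exact throughConn_of_E' hu hx hp

lemma not_E'_of_cut (hu : ω ∈ E' v u A) (huω : u ∈ ω) (hav : ω ∈ avoidConn (modCluster u v ω) u x) :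
    ω ∉ E' v x A := by
  obtain ⟨hx, hp⟩ := (mem_piv_iff_avoidConn (conn_of_E' hu)).2 ⟨huω, hav⟩
  exact fun h => h.2 ⟨u, hp, hu.1⟩

lemma cut_unique (hu : ω ∈ E' v u A) (huω : u ∈ ω) (hav : ω ∈ avoidConn (modCluster u v ω) u x)
    (hw : ω ∈ E' v w A) (hwω : w ∈ ω) (hav' : ω ∈ avoidConn (modCluster w v ω) w x) : u = w := by
  obtain ⟨hx, hp⟩ := (mem_piv_iff_avoidConn (conn_of_E' hu)).2 ⟨huω, hav⟩
  obtain ⟨-, hp'⟩ := (mem_piv_iff_avoidConn (conn_of_E' hw)).2 ⟨hwω, hav'⟩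
  by_contra hne
  rcases Joined.cut_total hx ((mem_piv_conn hx).1 hp) ((mem_piv_conn hx).1 hp') hne with h | h
  · exact hw.2 ⟨u, (mem_piv_conn (conn_of_E' hw)).2 h, hu.1⟩
  · exact hu.2 ⟨w, (mem_piv_conn (conn_of_E' hu)).2 h, hw.1⟩

/-! ### Locality -/

lemma joined_inter_iff_modCluster (B : Set (Site d)) :
    Joined (ω ∩ B) v u ↔ Joined (modCluster u v ω ∩ B) v u := by
  constructor
  · intro h
    obtain ⟨hvu, y, hy, hyu⟩ := joined_iff.1 h.sdiff_right
    refine (Reach.mono ?_ hy.within).joined_of_adj hyu hvu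
    rintro a ⟨ha, har⟩
    exact ⟨mem_modCluster.2 (har.mono fun b hb => ⟨hb.1.1, hb.2⟩), ha.1.2⟩
  · intro h
    refine h.sdiff_left.mono ?_
    rintro a ⟨⟨ha, haB⟩, hav⟩
    exact ⟨((mem_modCluster.1 ha).eq_or_mem.resolve_left hav).1, haB⟩

lemma joined_inter_iff_modCluster_of_cut (hvu : v ≠ u) (hcut : ¬ Joined (ω \ {y}) v u)
    (B : Set (Site d)) : Joined (ω ∩ B) v y ↔ Joined (modCluster u v ω ∩ B) v y := by
  constructor
  · intro h
    obtain ⟨hvy, z, hz, hzy⟩ := joined_iff.1 h.sdiff_right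
    rcases hz.first_hit {u} with hz | ⟨a, t, ha, hat, rfl, -⟩
    · refine (Reach.mono ?_ hz.within).joined_of_adj hzy hvy
      rintro a ⟨ha, har⟩
      exact ⟨mem_modCluster.2 (har.mono fun b hb => ⟨hb.1.1.1, hb.2⟩), ha.1.1.2⟩
    · exact absurd ((Reach.mono (T := ω \ {y})
        (fun b hb => ⟨hb.1.1.1, hb.1.2⟩) ha).joined_of_adj hat hvu) hcut
  · intro h
    refine h.sdiff_left.mono ?_
    rintro a ⟨⟨ha, haB⟩, hav⟩
    exact ⟨((mem_modCluster.1 ha).eq_or_mem.resolve_left hav).1, haB⟩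

lemma E'_of_modCluster_eq (h : modCluster u v ω = modCluster u v ω') (hE : ω ∈ E' v u A) :
    ω' ∈ E' v u A := by
  have hB : ∀ B : Set (Site d), Joined (ω ∩ B) v u ↔ Joined (ω' ∩ B) v u := fun B => by
    rw [joined_inter_iff_modCluster, h, ← joined_inter_iff_modCluster]
  have hconn : ω ∈ conn v u ↔ ω' ∈ conn v u := by simpa [conn] using hB Set.univ
  have hcut : ∀ y, Joined (ω \ {y}) v u ↔ Joined (ω' \ {y}) v u := fun y => by
    simpa [Set.sdiff_eq] using hB {y}ᶜ
  have hω' : ω' ∈ conn v u := hconn.1 hE.1.1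
  refine ⟨⟨hω', hE.1.2.imp_left fun hn hy => hn ((hB _).2 hy)⟩, ?_⟩
  rintro ⟨y, hy, hyA⟩
  have hy' := (mem_piv_conn hω').1 hy
  have hy'' : ¬ Joined (ω \ {y}) v u := fun hj => hy' ((hcut y).1 hj)
  have hBy : ∀ B : Set (Site d), Joined (ω ∩ B) v y ↔ Joined (ω' ∩ B) v y := fun B => by
    rw [joined_inter_iff_modCluster_of_cut hω'.1 hy'', h,
      ← joined_inter_iff_modCluster_of_cut hω'.1 hy']
  refine hE.2 ⟨y, (mem_piv_conn hE.1.1).2 hy'', ?_, hyA.2.imp_left fun hn hj => hn ((hBy _).1 hj)⟩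
  have := hyA.1
  simpa [conn] using (hBy Set.univ).2 (by simpa [conn] using this)

/-- The modified cluster is determined by the sites of its closed neighbourhood other than `u`. -/
lemma modCluster_eq_of_agree (hC : modCluster u v ω = C)
    (h : ∀ y ∈ thick C \ {u}, y ∈ ω' ↔ y ∈ ω) : modCluster u v ω' = C := by
  subst hC
  ext y
  constructor
  · intro hy
    refine (mem_modCluster.1 hy).rec_tail (mem_modCluster.2 (.refl _ _)) ?_
    intro b c _ hbc hc ih
    exact mem_modCluster.2 ((mem_modCluster.1 ih).tail hbc
      ⟨(h c ⟨mem_thick.2 (.inr ⟨b, ih, hbc⟩), hc.2⟩).1 hc.1, hc.2⟩)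
  · intro hy
    refine (mem_modCluster.1 hy).rec_tail (mem_modCluster.2 (.refl _ _)) ?_
    intro b c hb hbc hc ih
    refine mem_modCluster.2 ((mem_modCluster.1 ih).tail hbc ⟨(h c ⟨?_, hc.2⟩).2 hc.1, hc.2⟩)
    exact mem_thick.2 (.inl (mem_modCluster.2 (hb.tail hbc hc)))

/-! ### Measurability -/

section Measurability

variable {α : Type*} [MeasurableSpace α] {f g : α → Config d} {u v x y : Site d}

lemma measurable_mem_config (hf : Measurable f) (y : Site d) : Measurable fun a => y ∈ f a :=
  measurable_set_iff.1 hf y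

lemma measurable_inter_config (hf : Measurable f) (hg : Measurable g) :
    Measurable fun a => f a ∩ g a :=
  measurable_set_iff.2 fun y => (measurable_mem_config hf y).and (measurable_mem_config hg y)

lemma measurable_union_config (hf : Measurable f) (hg : Measurable g) :
    Measurable fun a => f a ∪ g a :=
  measurable_set_iff.2 fun y => (measurable_mem_config hf y).or (measurable_mem_config hg y)

lemma measurable_compl_config (hf : Measurable f) : Measurable fun a => (f a)ᶜ :=
  measurable_set_iff.2 fun y => (measurable_mem_config hf y).not

lemma measurable_sdiff_config (hf : Measurable f) (hg : Measurable g) :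
    Measurable fun a => f a \ g a := by
  simp only [Set.sdiff_eq]
  exact measurable_inter_config hf (measurable_compl_config hg)

/-- The sites reached from `u` in at most `n` steps through `S`. -/
def reachWithin (S : Set (Site d)) (u : Site d) : ℕ → Set (Site d)
  | 0 => {u}
  | n + 1 => reachWithin S u n ∪ {y | y ∈ S ∧ ∃ z, z ∈ reachWithin S u n ∧ Adj z y}

lemma reach_iff_exists_reachWithin {S : Set (Site d)} :
    Reach S u y ↔ ∃ n, y ∈ reachWithin S u n := by
  constructor
  · intro h
    refine h.rec_tail ⟨0, rfl⟩ ?_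
    rintro b c - hbc hc ⟨n, hn⟩
    exact ⟨n + 1, .inr ⟨hc, b, hn, hbc⟩⟩
  · rintro ⟨n, hn⟩
    induction n generalizing y with
    | zero => rw [show y = u from hn]; exact .refl _ _
    | succ n ih =>
      rcases hn with hn | ⟨hy, z, hz, hzy⟩
      · exact ih hn
      · exact (ih hz).tail hzy hy

lemma measurable_reach (hf : Measurable f) (u y : Site d) :
    Measurable fun a => Reach (f a) u y := by
  simp only [reach_iff_exists_reachWithin]
  refine Measurable.exists fun n => ?_
  induction n generalizing y with
  | zero => exact measurable_const
  | succ n ih =>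
    exact (ih y).or ((measurable_mem_config hf y).and
      (Measurable.exists fun z => (ih z).and measurable_const))

lemma measurable_joined (hf : Measurable f) (u x : Site d) :
    Measurable fun a => Joined (f a) u x := by
  simp only [joined_iff]
  exact measurable_const.and (Measurable.exists fun z => (measurable_reach hf u z).and
    measurable_const)

lemma measurable_thick (hf : Measurable f) : Measurable fun a => thick (f a) :=
  measurable_set_iff.2 fun y => (measurable_mem_config hf y).or <|
    Measurable.exists fun z => (measurable_mem_config hf z).and measurable_const

lemma measurable_modCluster (hf : Measurable f) (u v : Site d) :
    Measurable fun a => modCluster u v (f a) := by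
  refine measurable_set_iff.2 fun y => ?_
  simp only [mem_modCluster]
  exact measurable_reach (measurable_sdiff_config hf measurable_const) _ _

lemma measurable_mem_throughConn (hf : Measurable f) (hg : Measurable g) (u x : Site d) :
    Measurable fun a => g a ∈ throughConn (f a) u x :=
  (measurable_joined hg u x).and <|
    (measurable_joined (measurable_inter_config hg
      (measurable_compl_config (measurable_thick hf))) u x).not.or
        (measurable_mem_config (measurable_thick hf) x)

lemma measurable_mem_avoidConn (hf : Measurable f) (hg : Measurable g) (u x : Site d) :
    Measurable fun a => g a ∈ avoidConn (f a) u x :=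
  (measurable_joined (measurable_inter_config hg
      (measurable_compl_config (measurable_thick hf))) u x).and
        (measurable_mem_config (measurable_thick hf) x).not

lemma measurable_mem_E' (hf : Measurable f) (hg : Measurable g) (v u : Site d) :
    Measurable fun a => g a ∈ E' v u (f a) := by
  refine (measurable_mem_throughConn hf hg v u).and (Measurable.not (Measurable.exists fun y => ?_))
  refine Measurable.and (Measurable.and ?_ (Measurable.not ?_))
    (measurable_mem_throughConn hf hg v y)
  · exact measurable_joined (measurable_union_config hg measurable_const) v u
  · exact measurable_joined (measurable_sdiff_config hg measurable_const) v u

lemma measurableSet_conn (u x : Site d) : MeasurableSet (conn u x) :=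
  measurableSet_setOfPred.2 (measurable_joined measurable_id u x)

lemma measurableSet_throughConn (A : Set (Site d)) (u x : Site d) :
    MeasurableSet (throughConn A u x) :=
  measurableSet_setOfPred.2 (measurable_mem_throughConn measurable_const measurable_id u x)

lemma measurableSet_avoidConn (A : Set (Site d)) (u x : Site d) :
    MeasurableSet (avoidConn A u x) :=
  measurableSet_setOfPred.2 (measurable_mem_avoidConn measurable_const measurable_id u x)

lemma measurableSet_E' (v u : Site d) (A : Set (Site d)) : MeasurableSet (E' v u A) :=
  measurableSet_setOfPred.2 (measurable_mem_E' measurable_const measurable_id v u)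

lemma measurableSet_occupied (y : Site d) : MeasurableSet {ω : Config d | y ∈ ω} :=
  measurableSet_setOfPred.2 (measurable_mem_config measurable_id y)

lemma measurableSet_eq_config (hf : Measurable f) (C : Set (Site d)) :
    MeasurableSet {a | f a = C} := by
  simp only [Set.ext_iff]
  exact measurableSet_setOfPred.2 (Measurable.forall fun y =>
    (measurable_mem_config hf y).iff measurable_const)

lemma measurableSet_laceEvent (m : ℕ) (v : ℕ → Site d) : MeasurableSet (laceEvent m v) := by
  simp only [laceEvent, doubleConn_eq_E']
  refine measurableSet_setOfPred.2 (Measurable.and ?_ (Measurable.forall fun i =>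
    Measurable.imp measurable_const ?_))
  · exact measurable_mem_E' (g := fun ω : ℕ → Config d => ω 0) measurable_const
      (measurable_pi_apply 0) _ _
  · exact measurable_mem_E' (g := fun ω : ℕ → Config d => ω (i + 1))
      (measurable_modCluster (f := fun ω : ℕ → Config d => ω i) (measurable_pi_apply i) _ _)
      (measurable_pi_apply (i + 1)) _ _

end Measurability

/-! ### Product measures -/

section Splice

variable {ι : Type*} {X : ι → Type*} [∀ i, MeasurableSpace (X i)] (μ : ∀ i, Measure (X i))
  [∀ i, IsProbabilityMeasure (μ i)]

open Classical in
/-- Taking the coordinates in `S` and those outside `S` from two independent copies of a product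
measure gives the product measure. -/
lemma measurePreserving_splice (S : Set ι) :
    MeasurePreserving (fun (q : (∀ i, X i) × (∀ i, X i)) i => if i ∈ S then q.1 i else q.2 i)
      ((Measure.infinitePi μ).prod (Measure.infinitePi μ)) (Measure.infinitePi μ) := by
  have hmeas : Measurable
      (fun (q : (∀ i, X i) × (∀ i, X i)) i => if i ∈ S then q.1 i else q.2 i) := by
    refine measurable_pi_iff.2 fun i => ?_
    by_cases hi : i ∈ S <;> simp only [hi, if_true, if_false] <;> fun_prop
  refine ⟨hmeas, Measure.eq_infinitePi _ fun s t ht => ?_⟩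
  rw [Measure.map_apply hmeas (.pi s.countable_toSet fun i _ => ht i)]
  have : (fun (q : (∀ i, X i) × (∀ i, X i)) i => if i ∈ S then q.1 i else q.2 i) ⁻¹'
      (s : Set ι).pi t = ((s.filter (· ∈ S) : Finset ι) : Set ι).pi t ×ˢ
        ((s.filter (· ∉ S) : Finset ι) : Set ι).pi t := by
    ext q
    simp only [Set.mem_preimage, Set.mem_pi, Finset.mem_coe, Set.mem_prod, Finset.mem_filter]
    constructor
    · intro h
      exact ⟨fun i hi => by simpa [hi.2] using h i hi.1, fun i hi => by simpa [hi.2] using h i hi.1⟩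
    · intro h i hi
      by_cases hS : i ∈ S
      · simpa [hS] using h.1 i ⟨hi, hS⟩
      · simpa [hS] using h.2 i ⟨hi, hS⟩
  rw [this, Measure.prod_prod, Measure.infinitePi_pi _ fun i _ => ht i,
    Measure.infinitePi_pi _ fun i _ => ht i, Finset.prod_filter_mul_prod_filter_not]

end Splice

/-- The law of the state of a single site. -/
def siteLaw (p : unitInterval) : Measure Prop :=
  unitInterval.toNNReal p • Measure.dirac True +
    unitInterval.toNNReal (unitInterval.symm p) • Measure.dirac False

lemma siteLaw_apply (p : unitInterval) (t : Set Prop) [Decidable (True ∈ t)]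
    [Decidable (False ∈ t)] :
    siteLaw p t = (if True ∈ t then ENNReal.ofReal p else 0) +
      (if False ∈ t then ENNReal.ofReal (1 - p) else 0) := by
  have h1 : ((unitInterval.toNNReal p : NNReal) : ENNReal) = ENNReal.ofReal p := by
    rw [ENNReal.ofReal]; congr 1; ext; simp [p.2.1]
  have h2 : ((unitInterval.toNNReal (unitInterval.symm p) : NNReal) : ENNReal) =
      ENNReal.ofReal (1 - p) := by
    rw [ENNReal.ofReal]; congr 1; ext; simp [p.2.2]
  have hs : ∀ (a : NNReal) (μ : Measure Prop), (a • μ) t = (a : ENNReal) * μ t := fun a μ => rfl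
  rw [siteLaw, Measure.add_apply, hs, hs, h1, h2]
  simp [Set.indicator_apply]

instance (p : unitInterval) : IsProbabilityMeasure (siteLaw p) := by
  classical
  refine ⟨?_⟩
  rw [siteLaw_apply]
  simp only [Set.mem_univ, if_true]
  rw [← ENNReal.ofReal_add p.2.1 (by linarith [p.2.2])]
  simp

lemma perc_eq_map (d : ℕ) (p : unitInterval) :
    perc d p = (Measure.infinitePi fun _ : Site d => siteLaw p).map (fun P => {i | P i}) := by
  simp [perc, setBernoulli_eq_map, siteLaw]

lemma measurable_setOfPred_config : Measurable fun P : Site d → Prop => ({i | P i} : Config d) :=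
  measurable_set_iff.2 fun y => measurable_pi_apply y

lemma measurePreserving_setOfPred (d : ℕ) (p : unitInterval) :
    MeasurePreserving (fun P : Site d → Prop => ({i | P i} : Config d))
      (Measure.infinitePi fun _ : Site d => siteLaw p) (perc d p) :=
  ⟨measurable_setOfPred_config, (perc_eq_map d p).symm⟩

/-- Resampling the sites outside `S` preserves the percolation measure. -/
lemma measurePreserving_resample (p : unitInterval) (S : Set (Site d)) :
    MeasurePreserving (fun q : Config d × Config d => (q.1 ∩ S) ∪ (q.2 \ S))
      ((perc d p).prod (perc d p)) (perc d p) := by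
  have h1 := (measurePreserving_setOfPred d p).prod (measurePreserving_setOfPred d p)
  have h2 := (measurePreserving_setOfPred d p).comp
    (measurePreserving_splice (fun _ : Site d => siteLaw p) S)
  have hm : Measurable (fun q : Config d × Config d => (q.1 ∩ S) ∪ (q.2 \ S)) :=
    measurable_union_config (measurable_inter_config measurable_fst measurable_const)
      (measurable_sdiff_config measurable_snd measurable_const)
  refine ⟨hm, ?_⟩
  rw [← h1.map_eq, Measure.map_map hm h1.measurable, ← h2.map_eq]
  congr 1
  funext q
  ext y
  by_cases hy : y ∈ S <;> simp [hy]

/-- `A` depends only on the states of the sites in `S`. -/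
def DeterminedBy (A : Set (Config d)) (S : Set (Site d)) : Prop :=
  ∀ ω ω' : Config d, (∀ y ∈ S, y ∈ ω' ↔ y ∈ ω) → ω ∈ A → ω' ∈ A

lemma DeterminedBy.mono {A : Set (Config d)} {S T : Set (Site d)} (h : DeterminedBy A S)
    (hST : S ⊆ T) : DeterminedBy A T :=
  fun ω ω' hω => h ω ω' fun y hy => hω y (hST hy)

lemma DeterminedBy.inter {A B : Set (Config d)} {S : Set (Site d)} (hA : DeterminedBy A S)
    (hB : DeterminedBy B S) : DeterminedBy (A ∩ B) S :=
  fun ω η hω h => ⟨hA ω η hω h.1, hB ω η hω h.2⟩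

/-- Events depending on disjoint sets of sites are independent. -/
lemma perc_inter (p : unitInterval) {A B : Set (Config d)} {S : Set (Site d)}
    (hA : MeasurableSet A) (hB : MeasurableSet B) (hAS : DeterminedBy A S)
    (hBS : DeterminedBy B Sᶜ) : perc d p (A ∩ B) = perc d p A * perc d p B := by
  rw [← (measurePreserving_resample p S).measure_preimage (hA.inter hB).nullMeasurableSet,
    ← Measure.prod_prod]
  congr 1
  ext q
  have h1 : ∀ y ∈ S, y ∈ (q.1 ∩ S) ∪ (q.2 \ S) ↔ y ∈ q.1 := fun y hy => by simp [hy]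
  have h2 : ∀ y ∈ Sᶜ, y ∈ (q.1 ∩ S) ∪ (q.2 \ S) ↔ y ∈ q.2 := fun y hy => by
    simp [show y ∉ S from hy]
  simp only [Set.mem_preimage, Set.mem_inter_iff, Set.mem_prod]
  exact and_congr ⟨hAS _ _ fun y hy => (h1 y hy).symm, hAS _ _ h1⟩
    ⟨hBS _ _ fun y hy => (h2 y hy).symm, hBS _ _ h2⟩

lemma perc_occupied (p : unitInterval) (y : Site d) :
    perc d p {ω | y ∈ ω} = ENNReal.ofReal p := by
  classical
  rw [← (measurePreserving_setOfPred d p).measure_preimage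
    (measurableSet_occupied y).nullMeasurableSet]
  have : (fun P : Site d → Prop => ({i | P i} : Config d)) ⁻¹' {ω | y ∈ ω} =
      (({y} : Finset (Site d)) : Set (Site d)).pi fun _ => {True} := by
    ext P; simp
  rw [this, Measure.infinitePi_pi _ (by simp), Finset.prod_singleton, siteLaw_apply]
  simp

/-! ### Translation invariance -/

/-- The configuration seen from `a`. -/
def shift (a : Site d) (ω : Config d) : Config d := {y | y + a ∈ ω}

lemma measurePreserving_shift (p : unitInterval) (a : Site d) :
    MeasurePreserving (shift a) (perc d p) (perc d p) := by
  have hm : Measurable (shift a : Config d → Config d) :=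
    measurable_set_iff.2 fun y => measurable_mem_config measurable_id (y + a)
  refine ⟨hm, ?_⟩
  have h1 := measurePreserving_setOfPred d p
  have hm' : Measurable fun (P : Site d → Prop) i => P (i + a) := by fun_prop
  have h2 : MeasurePreserving (fun (P : Site d → Prop) i => P (i + a))
      (Measure.infinitePi fun _ : Site d => siteLaw p)
      (Measure.infinitePi fun _ : Site d => siteLaw p) := by
    refine ⟨hm', Measure.eq_infinitePi _ fun s t ht => ?_⟩
    rw [Measure.map_apply hm' (.pi s.countable_toSet fun i _ => ht i)]
    have : (fun (P : Site d → Prop) i => P (i + a)) ⁻¹' (s : Set (Site d)).pi t =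
        ((s.map (addRightEmbedding a) : Finset (Site d)) : Set (Site d)).pi
          fun i => t (i - a) := by
      ext P
      simp only [Set.mem_preimage, Set.mem_pi, Finset.mem_coe, Finset.mem_map, forall_exists_index,
        and_imp, forall_apply_eq_imp_iff₂, addRightEmbedding_apply, add_sub_cancel_right]
    rw [this, Measure.infinitePi_pi _ fun i _ => ht _, Finset.prod_map]
    simp
  have h3 := h1.comp h2
  rw [← h1.map_eq, Measure.map_map hm h1.measurable]
  conv_rhs => rw [h1.map_eq, ← h3.map_eq]
  rfl

lemma adj_add_right {a b c : Site d} : Adj (a + c) (b + c) ↔ Adj a b := by simp [Adj]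

lemma Reach.shift_iff {a u y : Site d} {ω : Config d} :
    Reach (shift a ω) u y ↔ Reach ω (u + a) (y + a) := by
  constructor
  · intro h
    exact h.rec_tail (.refl _ _) fun b c _ hbc hc ih => ih.tail (adj_add_right.2 hbc) hc
  · intro h
    have : Reach (shift a ω) u ((y + a) - a) := by
      refine h.rec_tail (motive := fun z => Reach (shift a ω) u (z - a))
        (by simp; exact .refl _ _) ?_
      intro b c _ hbc hc ih
      refine ih.tail (by rw [sub_eq_add_neg, sub_eq_add_neg]; exact adj_add_right.2 hbc) ?_
      simpa [shift] using hc
    simpa using this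

lemma joined_shift_iff {a u x : Site d} {ω : Config d} :
    Joined (shift a ω) u x ↔ Joined ω (u + a) (x + a) := by
  simp only [joined_iff, Reach.shift_iff]
  refine and_congr (by simp) ⟨?_, ?_⟩
  · rintro ⟨y, hy, hyx⟩
    exact ⟨y + a, hy, adj_add_right.2 hyx⟩
  · rintro ⟨y, hy, hyx⟩
    refine ⟨y - a, by simpa using hy, ?_⟩
    rw [← adj_add_right (c := a)]; simpa using hyx

/-- The two-point function with values in `[0,∞]`. -/
def etau (p : unitInterval) (x : Site d) : ENNReal := perc d p (conn 0 x)

lemma perc_conn (p : unitInterval) (u x : Site d) : perc d p (conn u x) = etau p (x - u) := by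
  rw [etau, ← (measurePreserving_shift p u).measure_preimage
    (measurableSet_conn 0 (x - u)).nullMeasurableSet]
  congr 1
  ext ω
  simp [conn, joined_shift_iff]

/-! ### The independent sequence -/

instance (d : ℕ) (p : unitInterval) : IsProbabilityMeasure (percSeq d p) := by
  unfold percSeq; infer_instance

/-- If `F ω ω'` does not depend on the coordinate `n` of `ω`, then the coordinate `n` can be
integrated separately. -/
lemma lintegral_percSeq_eval (p : unitInterval) (n : ℕ)
    (F : (ℕ → Config d) → Config d → ENNReal) (hF : Measurable fun q : (ℕ → Config d) × Config d =>
      F q.1 q.2) (hdep : ∀ ω ω' η, (∀ i, i ≠ n → ω i = ω' i) → F ω η = F ω' η) :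
    ∫⁻ ω, F ω (ω n) ∂percSeq d p = ∫⁻ ω, ∫⁻ η, F ω η ∂perc d p ∂percSeq d p := by
  classical
  have h := measurePreserving_splice (fun _ : ℕ => perc d p) {n}ᶜ
  have hm : Measurable fun ω : ℕ → Config d => F ω (ω n) :=
    hF.comp (measurable_id.prodMk (measurable_pi_apply n))
  have hev := measurePreserving_eval_infinitePi (fun _ : ℕ => perc d p) n
  rw [percSeq, ← h.lintegral_comp hm, lintegral_prod]
  · refine lintegral_congr fun ω => ?_
    rw [← hev.lintegral_comp (f := F ω) (hF.comp (measurable_const.prodMk measurable_id))]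
    refine lintegral_congr fun ω' => ?_
    rw [hdep _ ω _ (fun i hi => by simp [hi])]
    simp
  · exact (hm.comp h.measurable).aemeasurable

/-! ### One step of the expansion -/

lemma tsum_etau_sub (p : unitInterval) (v : Site d) :
    ∑' y, etau p (y - v) = ∑' y : Site d, etau p y :=
  (Equiv.subRight v).tsum_eq (fun y => etau p y)

lemma tsum_etau_sub_left (p : unitInterval) (g : Site d → ENNReal) :
    ∑' x, ∑' y, g y * etau p (x - y) = (∑' y, g y) * ∑' y : Site d, etau p y := by
  rw [ENNReal.tsum_comm, ← ENNReal.tsum_mul_right]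
  exact tsum_congr fun y => by rw [ENNReal.tsum_mul_left, tsum_etau_sub]

lemma ae_finite_modCluster {p : unitInterval} (hχ : ∑' y : Site d, etau p y ≠ ⊤) (u v : Site d) :
    ∀ᵐ ω ∂perc d p, (modCluster u v ω).Finite := by
  have h : ∑' y, perc d p (conn v y) ≠ ⊤ := by simpa only [perc_conn, tsum_etau_sub] using hχ
  filter_upwards [ae_finite_setOfPred_mem h] with ω hω
  refine (hω.insert v).subset fun y hy => ?_
  rcases modCluster_subset_cluster u v ω hy with hy | hy
  · exact .inl hy
  · exact .inr hy.2

lemma measurableSet_modCluster_eq (u v : Site d) (C : Set (Site d)) :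
    MeasurableSet {ω : Config d | modCluster u v ω = C} :=
  measurableSet_eq_config (measurable_modCluster measurable_id u v) C

lemma lintegral_eq_tsum_modCluster {ν : Measure (Config d)} {u v : Site d}
    (h : ∀ᵐ ω ∂ν, (modCluster u v ω).Finite) (f : Config d → ENNReal) :
    ∫⁻ ω, f ω ∂ν = ∑' C : Finset (Site d), ∫⁻ ω in {ω | modCluster u v ω = C}, f ω ∂ν := by
  rw [← lintegral_iUnion (fun C : Finset (Site d) => measurableSet_modCluster_eq u v C)]
  · conv_lhs => rw [← setLIntegral_univ]
    refine setLIntegral_congr (Filter.EventuallyEq.symm ?_)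
    rw [MeasureTheory.ae_eq_univ]
    refine measure_mono_null ?_ (ae_iff.1 h)
    intro ω hω hfin
    exact hω (Set.mem_iUnion.2 ⟨hfin.toFinset, by simp⟩)
  · intro C C' hCC
    refine Set.disjoint_left.2 fun ω h1 h2 => hCC ?_
    exact Finset.coe_injective ((show _ = _ from h1).symm.trans h2)

lemma determinedBy_E'_inter (v u : Site d) (A C : Set (Site d)) :
    DeterminedBy (E' v u A ∩ {ω | modCluster u v ω = C}) (thick C \ {u}) := by
  rintro ω ω' h ⟨h1, h2⟩
  have h3 := modCluster_eq_of_agree h2 h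
  exact ⟨E'_of_modCluster_eq (h2.trans h3.symm) h1, h3⟩

lemma determinedBy_connIn (A : Set (Site d)) (u x : Site d) :
    DeterminedBy (connIn A u x) (A \ {u}) := by
  intro ω ω' h hω
  refine (Joined.sdiff_left hω).mono ?_
  rintro a ⟨⟨ha, haA⟩, hau⟩
  exact ⟨(h a ⟨haA, hau⟩).2 ha, haA⟩

lemma determinedBy_avoidConn (C : Set (Site d)) (u x : Site d) :
    DeterminedBy (avoidConn C u x) ((thick C)ᶜ \ {u}) :=
  fun ω ω' h hω => ⟨determinedBy_connIn _ u x ω ω' h hω.1, hω.2⟩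

lemma determinedBy_occupied (y : Site d) : DeterminedBy {ω : Config d | y ∈ ω} {y} :=
  fun _ _ h hω => (h y rfl).2 hω

lemma perc_cut_inter (p : unitInterval) (v u x : Site d) (A C : Set (Site d)) :
    perc d p ((E' v u A ∩ {ω | modCluster u v ω = C}) ∩ ({ω | u ∈ ω} ∩ avoidConn C u x)) =
      perc d p (E' v u A ∩ {ω | modCluster u v ω = C}) *
        (ENNReal.ofReal p * perc d p (avoidConn C u x)) := by
  rw [perc_inter p ((measurableSet_E' v u A).inter (measurableSet_modCluster_eq u v C))
      ((measurableSet_occupied u).inter (measurableSet_avoidConn C u x))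
      (determinedBy_E'_inter v u A C) (DeterminedBy.inter
        ((determinedBy_occupied u).mono ?_) ((determinedBy_avoidConn C u x).mono ?_)),
    perc_inter p (measurableSet_occupied u) (measurableSet_avoidConn C u x)
      (determinedBy_occupied u) ((determinedBy_avoidConn C u x).mono ?_), perc_occupied]
  · exact fun a ha => ha.2
  · rintro a rfl h
    exact h.2 rfl
  · exact fun a ha h => ha.1 h.1

lemma measurable_perc_of_joint {α : Type*} [MeasurableSpace α] (p : unitInterval)
    {B : α → Set (Config d)} (hB : Measurable fun q : α × Config d => q.2 ∈ B q.1) :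
    Measurable fun a => perc d p (B a) :=
  measurable_measure_prodMk_left (measurableSet_setOfPred.2 hB)

lemma perc_cut {p : unitInterval} (hχ : ∑' y : Site d, etau p y ≠ ⊤) (v u x : Site d)
    (A : Set (Site d)) :
    perc d p {ω | ω ∈ E' v u A ∧ u ∈ ω ∧ ω ∈ avoidConn (modCluster u v ω) u x} =
      ENNReal.ofReal p *
        ∫⁻ ω in E' v u A, perc d p (avoidConn (modCluster u v ω) u x) ∂perc d p := by
  have hfin := ae_finite_modCluster hχ u v
  rw [← setLIntegral_one, lintegral_eq_tsum_modCluster (ae_restrict_of_ae hfin),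
    lintegral_eq_tsum_modCluster (ae_restrict_of_ae hfin), ← ENNReal.tsum_mul_left]
  refine tsum_congr fun C => ?_
  have hC := measurableSet_modCluster_eq u v (C : Set (Site d))
  rw [Measure.restrict_restrict hC, Measure.restrict_restrict hC, setLIntegral_one,
    setLIntegral_congr_fun (g := fun _ => perc d p (avoidConn C u x))
      (hC.inter (measurableSet_E' v u A))
      (fun ω hω => by rw [show modCluster u v ω = C from hω.1]),
    setLIntegral_const, Set.inter_comm _ (E' v u A), mul_comm (perc d p (avoidConn C u x)),
    mul_left_comm, ← perc_cut_inter]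
  congr 1
  ext ω
  simp only [Set.mem_inter_iff, Set.mem_ofPred_eq]
  constructor
  · rintro ⟨h1, h2, h3, h4⟩
    exact ⟨⟨h2, h1⟩, h3, h1 ▸ h4⟩
  · rintro ⟨⟨h2, h1⟩, h3, h4⟩
    exact ⟨h1, h2, h3, by rwa [h1]⟩

lemma perc_avoidConn_add (p : unitInterval) (A : Set (Site d)) (u x : Site d) :
    perc d p (avoidConn A u x) + perc d p (throughConn A u x) = etau p (x - u) := by
  have hsub : throughConn A u x ⊆ conn u x := fun ω hω => hω.1
  rw [avoidConn_eq, ← perc_conn, ← measure_sdiff_add_inter (conn u x)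
    (measurableSet_throughConn A u x), Set.inter_eq_self_of_subset_right hsub]

/-- The probability of a connection through `A`, expanded at the first pivotal point to which `v` is
connected through `A`. -/
lemma perc_throughConn_add {p : unitInterval} (hχ : ∑' y : Site d, etau p y ≠ ⊤) (v x : Site d)
    (A : Set (Site d)) :
    perc d p (throughConn A v x) + ENNReal.ofReal p * ∑' u, ∫⁻ ω in E' v u A,
        perc d p (throughConn (modCluster u v ω) u x) ∂perc d p =
      perc d p (E' v x A) + ENNReal.ofReal p * ∑' u, perc d p (E' v u A) * etau p (x - u) := by
  have hset : throughConn A v x = E' v x A ∪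
      ⋃ u, {ω | ω ∈ E' v u A ∧ u ∈ ω ∧ ω ∈ avoidConn (modCluster u v ω) u x} := by
    ext ω
    rw [throughConn_iff, Set.mem_union, Set.mem_iUnion]
    rfl
  have hmeas : ∀ u, MeasurableSet
      {ω | ω ∈ E' v u A ∧ u ∈ ω ∧ ω ∈ avoidConn (modCluster u v ω) u x} := fun u =>
    measurableSet_setOfPred.2 ((measurable_mem_E' measurable_const measurable_id v u).and
      ((measurable_mem_config measurable_id u).and
        (measurable_mem_avoidConn (measurable_modCluster measurable_id u v) measurable_id u x)))
  have hm1 : ∀ u, Measurable fun ω => perc d p (avoidConn (modCluster u v ω) u x) := fun u =>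
    measurable_perc_of_joint p (measurable_mem_avoidConn
      (measurable_modCluster measurable_fst u v) measurable_snd u x)
  rw [hset, measure_union _ (MeasurableSet.iUnion hmeas), measure_iUnion _ hmeas, add_assoc]
  · congr 1
    simp only [perc_cut hχ]
    rw [ENNReal.tsum_mul_left, ← mul_add, ← ENNReal.tsum_add]
    congr 2
    funext u
    rw [← lintegral_add_left (hm1 u)]
    simp only [perc_avoidConn_add]
    rw [setLIntegral_const, mul_comm]
  · intro u w huw
    refine Set.disjoint_left.2 fun ω h1 h2 => huw ?_
    exact cut_unique h1.1 h1.2.1 h1.2.2 h2.1 h2.2.1 h2.2.2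
  · refine Set.disjoint_left.2 fun ω h1 h2 => ?_
    obtain ⟨u, hu⟩ := Set.mem_iUnion.1 h2
    exact not_E'_of_cut hu.1 hu.2.1 hu.2.2 h1

/-! ### Iteration -/

lemma laceEvent_congr {m : ℕ} {v v' : ℕ → Site d} (h : ∀ k ≤ m + 1, v k = v' k) :
    laceEvent m v = laceEvent m v' := by
  ext ω
  simp only [laceEvent, Set.mem_ofPred_eq]
  rw [h 0 (by omega), h 1 (by omega)]
  refine and_congr_right fun _ => forall₂_congr fun i hi => ?_
  rw [h i (by omega), h (i + 1) (by omega), h (i + 2) (by omega)]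

lemma laceEvent_succ (n : ℕ) (v : ℕ → Site d) : laceEvent (n + 1) v = laceEvent n v ∩
    {ω | ω (n + 1) ∈ E' (v (n + 1)) (v (n + 2)) (modCluster (v (n + 1)) (v n) (ω n))} := by
  ext ω
  simp only [laceEvent, Set.mem_inter_iff, Set.mem_ofPred_eq, Nat.forall_lt_succ_right, and_assoc]

lemma mem_laceEvent_of_agree {n : ℕ} {v : ℕ → Site d} {ω ω' : ℕ → Config d}
    (h : ∀ i ≤ n, ω i = ω' i) (hω : ω ∈ laceEvent n v) : ω' ∈ laceEvent n v := by
  refine ⟨h 0 (by omega) ▸ hω.1, fun i hi => ?_⟩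
  rw [← h i (by omega), ← h (i + 1) (by omega)]
  exact hω.2 i hi

/-- Integrating out the last configuration. -/
lemma setLIntegral_laceEvent_inter (p : unitInterval) (n : ℕ) (v : ℕ → Site d) (a b : Site d)
    {B : Config d → Set (Config d)} (hB : Measurable fun q : Config d × Config d => q.2 ∈ B q.1)
    {f : Config d → ENNReal} (hf : Measurable f) :
    ∫⁻ ω in laceEvent n v ∩ {ω | ω (n + 1) ∈ B (modCluster a b (ω n))}, f (ω (n + 1)) ∂percSeq d p =
      ∫⁻ ω in laceEvent n v, ∫⁻ η in B (modCluster a b (ω n)), f η ∂perc d p ∂percSeq d p := by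
  classical
  have hmC : Measurable fun ω : ℕ → Config d => modCluster a b (ω n) :=
    measurable_modCluster (f := fun ω : ℕ → Config d => ω n) (measurable_pi_apply n) a b
  have hBm : ∀ A, MeasurableSet (B A) := fun A =>
    measurableSet_setOfPred.2 (hB.comp (measurable_const.prodMk measurable_id))
  have hset : MeasurableSet {ω : ℕ → Config d | ω (n + 1) ∈ B (modCluster a b (ω n))} :=
    measurableSet_setOfPred.2 (hB.comp (hmC.prodMk (measurable_pi_apply (n + 1))))
  have hL := measurableSet_laceEvent n v
  rw [← lintegral_indicator (hL.inter hset), ← lintegral_indicator hL]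
  let F : (ℕ → Config d) → Config d → ENNReal := fun ω η =>
    if ω ∈ laceEvent n v ∧ η ∈ B (modCluster a b (ω n)) then f η else 0
  have hF : Measurable fun q : (ℕ → Config d) × Config d => F q.1 q.2 := by
    refine Measurable.ite (measurableSet_setOfPred.2 (Measurable.and ?_ ?_))
      (hf.comp measurable_snd) measurable_const
    · exact (measurableSet_setOfPred.1 hL).comp measurable_fst
    · exact hB.comp ((hmC.comp measurable_fst).prodMk measurable_snd)
  have key := lintegral_percSeq_eval p (n + 1) F hF (fun ω ω' η h => by
    have h1 : ω ∈ laceEvent n v ↔ ω' ∈ laceEvent n v :=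
      ⟨mem_laceEvent_of_agree fun i hi => h i (by omega),
        mem_laceEvent_of_agree fun i hi => (h i (by omega)).symm⟩
    simp only [F, h1, h n (by omega)])
  convert key using 2
  · funext ω
    simp [F, Set.indicator_apply]
  · funext ω
    by_cases hω : ω ∈ laceEvent n v
    · simp only [Set.indicator_of_mem hω, F, hω, true_and]
      rw [← lintegral_indicator (hBm _)]
      simp [Set.indicator_apply]
    · simp [F, hω]

lemma percSeq_laceEvent_inter (p : unitInterval) (n : ℕ) (v : ℕ → Site d) (a b : Site d)
    {B : Config d → Set (Config d)} (hB : Measurable fun q : Config d × Config d => q.2 ∈ B q.1) :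
    percSeq d p (laceEvent n v ∩ {ω | ω (n + 1) ∈ B (modCluster a b (ω n))}) =
      ∫⁻ ω in laceEvent n v, perc d p (B (modCluster a b (ω n))) ∂percSeq d p := by
  simpa using setLIntegral_laceEvent_inter p n v a b hB measurable_one

lemma percSeq_remainderEvent (p : unitInterval) (n : ℕ) (v : ℕ → Site d) :
    percSeq d p (remainderEvent n v) = ∫⁻ ω in laceEvent n v,
      perc d p (throughConn (modCluster (v (n + 1)) (v n) (ω n)) (v (n + 1)) (v (n + 2)))
        ∂percSeq d p :=
  percSeq_laceEvent_inter p n v (v (n + 1)) (v n)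
    (B := fun A => throughConn A (v (n + 1)) (v (n + 2)))
    (measurable_mem_throughConn measurable_fst measurable_snd _ _)

lemma percSeq_laceEvent_succ (p : unitInterval) (n : ℕ) (v : ℕ → Site d) :
    percSeq d p (laceEvent (n + 1) v) = ∫⁻ ω in laceEvent n v,
      perc d p (E' (v (n + 1)) (v (n + 2)) (modCluster (v (n + 1)) (v n) (ω n)))
        ∂percSeq d p := by
  rw [laceEvent_succ]
  exact percSeq_laceEvent_inter p n v (v (n + 1)) (v n)
    (B := fun A => E' (v (n + 1)) (v (n + 2)) A)
    (measurable_mem_E' measurable_fst measurable_snd _ _)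

lemma vertexSeq_snoc {m : ℕ} (u : Fin m → Site d) (x y : Site d) {k : ℕ} (hk : k ≤ m + 1) :
    vertexSeq (Fin.snoc (α := fun _ => Site d) u y) x k = vertexSeq u y k := by
  rcases k with _ | k
  · rfl
  · rw [vertexSeq, vertexSeq, dif_pos (by omega)]
    rcases Nat.lt_or_ge k m with h | h
    · rw [dif_pos h]
      exact Fin.snoc_castSucc (α := fun _ => Site d) y u ⟨k, h⟩
    · have : k = m := by omega
      subst this
      rw [dif_neg (by omega)]
      exact Fin.snoc_last (α := fun _ => Site d) y u

lemma vertexSeq_last {m : ℕ} (u : Fin m → Site d) (x : Site d) : vertexSeq u x (m + 1) = x := by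
  simp [vertexSeq]

lemma vertexSeq_of_le {m : ℕ} (u : Fin m → Site d) (x y : Site d) {k : ℕ} (hk : k ≤ m) :
    vertexSeq u x k = vertexSeq u y k := by
  rcases k with _ | k
  · rfl
  · rw [vertexSeq, vertexSeq, dif_pos (by omega), dif_pos (by omega)]

lemma tsum_snoc {m : ℕ} (g : (Fin (m + 1) → Site d) → ENNReal) :
    ∑' u, g u = ∑' y, ∑' u : Fin m → Site d, g (Fin.snoc (α := fun _ => Site d) u y) := by
  rw [← (Fin.snocEquiv fun _ : Fin (m + 1) => Site d).tsum_eq g]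
  exact ENNReal.tsum_prod (f := fun y u => g (Fin.snoc (α := fun _ => Site d) u y))

/-- The series of the coefficients, with values in `[0,∞]`. -/
def laceSum (p : unitInterval) (m : ℕ) (x : Site d) : ENNReal :=
  ∑' u : Fin m → Site d, percSeq d p (laceEvent m (vertexSeq u x))

/-- The series of the remainder, with values in `[0,∞]`. -/
def remSum (p : unitInterval) (n : ℕ) (x : Site d) : ENNReal :=
  ∑' u : Fin (n + 1) → Site d, percSeq d p (remainderEvent n (vertexSeq u x))

lemma percSeq_remainderEvent_snoc (p : unitInterval) (m : ℕ) (u : Fin m → Site d) (x y : Site d) :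
    percSeq d p (remainderEvent m (vertexSeq (Fin.snoc (α := fun _ => Site d) u y) x)) =
      ∫⁻ ω in laceEvent m (vertexSeq u y),
        perc d p (throughConn (modCluster y (vertexSeq u y m) (ω m)) y x) ∂percSeq d p := by
  rw [percSeq_remainderEvent, laceEvent_congr fun k hk => vertexSeq_snoc u x y hk,
    vertexSeq_last, vertexSeq_snoc u x y le_rfl, vertexSeq_last, vertexSeq_snoc u x y (by omega)]

lemma remSum_le (p : unitInterval) (n : ℕ) (x : Site d) :
    remSum p n x ≤ ∑' y, laceSum p n y * etau p (x - y) := by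
  rw [remSum, tsum_snoc]
  refine ENNReal.tsum_le_tsum fun y => ?_
  rw [laceSum, ← ENNReal.tsum_mul_right]
  refine ENNReal.tsum_le_tsum fun u => ?_
  rw [percSeq_remainderEvent_snoc, mul_comm, ← setLIntegral_const]
  refine lintegral_mono fun ω => ?_
  rw [← perc_conn]
  exact measure_mono fun ω hω => hω.1

lemma laceSum_succ_le (p : unitInterval) (n : ℕ) (x : Site d) :
    laceSum p (n + 1) x ≤ remSum p n x :=
  ENNReal.tsum_le_tsum fun u => measure_mono <| by
    rw [laceEvent_succ]
    exact Set.inter_subset_inter_right _ fun ω hω => hω.1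

lemma laceEvent_zero (v : ℕ → Site d) :
    laceEvent 0 v = (fun ω : ℕ → Config d => ω 0) ⁻¹' E' (v 0) (v 1) Set.univ := by
  ext ω
  simp [laceEvent, doubleConn_eq_E']

lemma setLIntegral_laceEvent_zero (p : unitInterval) (v : ℕ → Site d) {f : Config d → ENNReal}
    (hf : Measurable f) : ∫⁻ ω in laceEvent 0 v, f (ω 0) ∂percSeq d p =
      ∫⁻ η in E' (v 0) (v 1) Set.univ, f η ∂perc d p := by
  rw [laceEvent_zero]
  exact (measurePreserving_eval_infinitePi (fun _ : ℕ => perc d p) 0).setLIntegral_comp_preimage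
    (measurableSet_E' _ _ _) hf

lemma laceSum_zero (p : unitInterval) (x : Site d) :
    laceSum p 0 x = perc d p (doubleConn 0 x) := by
  rw [laceSum, tsum_eq_single default (fun u hu => absurd (Subsingleton.elim _ _) hu),
    ← setLIntegral_one, setLIntegral_laceEvent_zero p _ (f := fun _ => 1) measurable_const,
    setLIntegral_one, doubleConn_eq_E']
  rfl

lemma tsum_laceSum_ne_top {p : unitInterval} (hχ : ∑' y : Site d, etau p y ≠ ⊤) (m : ℕ) :
    ∑' x : Site d, laceSum p m x ≠ ⊤ := by
  induction m with
  | zero =>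
    refine ne_top_of_le_ne_top hχ (ENNReal.tsum_le_tsum fun x => ?_)
    rw [laceSum_zero, doubleConn_eq_E']
    exact measure_mono fun ω hω => hω.1.1
  | succ n ih =>
    refine ne_top_of_le_ne_top (ENNReal.mul_ne_top ih hχ) ?_
    rw [← tsum_etau_sub_left]
    exact ENNReal.tsum_le_tsum fun x => (laceSum_succ_le p n x).trans (remSum_le p n x)

lemma tsum_laceSum_mul_etau_ne_top {p : unitInterval} (hχ : ∑' y : Site d, etau p y ≠ ⊤) (m : ℕ)
    (x : Site d) : ∑' y, laceSum p m y * etau p (x - y) ≠ ⊤ := by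
  refine ne_top_of_le_ne_top (tsum_laceSum_ne_top hχ m) (ENNReal.tsum_le_tsum fun y => ?_)
  exact mul_le_of_le_one_right' prob_le_one

lemma measurable_perc_throughConn (p : unitInterval) (u v x : Site d) :
    Measurable fun ω => perc d p (throughConn (modCluster u v ω) u x) :=
  measurable_perc_of_joint p (measurable_mem_throughConn
    (measurable_modCluster measurable_fst u v) measurable_snd u x)

lemma etau_add_remSum {p : unitInterval} (hχ : ∑' y : Site d, etau p y ≠ ⊤) (x : Site d) :
    etau p x + ENNReal.ofReal p * remSum p 0 x =
      laceSum p 0 x + ENNReal.ofReal p * ∑' y, laceSum p 0 y * etau p (x - y) := by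
  have h := perc_throughConn_add hχ 0 x Set.univ
  simp only [throughConn_univ, ← doubleConn_eq_E', ← laceSum_zero] at h
  rw [← etau] at h
  rw [← h, remSum, tsum_snoc]
  congr 2
  refine tsum_congr fun y => ?_
  rw [tsum_eq_single default (fun u hu => absurd (Subsingleton.elim _ _) hu),
    percSeq_remainderEvent_snoc, doubleConn_eq_E']
  exact setLIntegral_laceEvent_zero p _ (measurable_perc_throughConn p y 0 x)

lemma remSum_add_remSum {p : unitInterval} (hχ : ∑' y : Site d, etau p y ≠ ⊤) (n : ℕ)
    (x : Site d) : remSum p n x + ENNReal.ofReal p * remSum p (n + 1) x =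
      laceSum p (n + 1) x + ENNReal.ofReal p * ∑' y, laceSum p (n + 1) y * etau p (x - y) := by
  have hrem : remSum p (n + 1) x = ∑' u : Fin (n + 1) → Site d, ∑' y,
      ∫⁻ ω in laceEvent (n + 1) (vertexSeq u y),
        perc d p (throughConn (modCluster y (vertexSeq u y (n + 1)) (ω (n + 1))) y x)
          ∂percSeq d p := by
    rw [remSum, tsum_snoc, ENNReal.tsum_comm]
    simp only [percSeq_remainderEvent_snoc]
  have hlace : ∑' y, laceSum p (n + 1) y * etau p (x - y) = ∑' u : Fin (n + 1) → Site d, ∑' y,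
      percSeq d p (laceEvent (n + 1) (vertexSeq u y)) * etau p (x - y) := by
    simp only [laceSum, ← ENNReal.tsum_mul_right]
    rw [ENNReal.tsum_comm]
  rw [hrem, hlace, remSum, laceSum, ← ENNReal.tsum_mul_left, ← ENNReal.tsum_mul_left,
    ← ENNReal.tsum_add, ← ENNReal.tsum_add]
  refine tsum_congr fun u => ?_
  set w := vertexSeq u x (n + 1) with hw
  set b := vertexSeq u x n with hb
  set L := laceEvent n (vertexSeq u x) with hL
  have hwy : ∀ y, vertexSeq u y (n + 1) = w := fun y => vertexSeq_of_le u y x le_rfl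
  have hby : ∀ y, vertexSeq u y n = b := fun y => vertexSeq_of_le u y x (by omega)
  have hLy : ∀ y, laceEvent n (vertexSeq u y) = L := fun y =>
    laceEvent_congr fun k hk => vertexSeq_of_le u y x hk
  have hEm : ∀ y, Measurable fun q : Config d × Config d => q.2 ∈ E' w y q.1 := fun y =>
    measurable_mem_E' measurable_fst measurable_snd w y
  have hmC : Measurable fun ω : ℕ → Config d => modCluster w b (ω n) :=
    measurable_modCluster (f := fun ω : ℕ → Config d => ω n) (measurable_pi_apply n) w b
  have h1 : percSeq d p (remainderEvent n (vertexSeq u x)) =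
      ∫⁻ ω in L, perc d p (throughConn (modCluster w b (ω n)) w x) ∂percSeq d p := by
    rw [percSeq_remainderEvent, vertexSeq_last]
  have h2 : ∀ y, percSeq d p (laceEvent (n + 1) (vertexSeq u y)) =
      ∫⁻ ω in L, perc d p (E' w y (modCluster w b (ω n))) ∂percSeq d p := fun y => by
    rw [percSeq_laceEvent_succ, vertexSeq_last, hwy, hby, hLy]
  have h3 : ∀ y, ∫⁻ ω in laceEvent (n + 1) (vertexSeq u y),
      perc d p (throughConn (modCluster y (vertexSeq u y (n + 1)) (ω (n + 1))) y x) ∂percSeq d p =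
      ∫⁻ ω in L, ∫⁻ η in E' w y (modCluster w b (ω n)),
        perc d p (throughConn (modCluster y w η) y x) ∂perc d p ∂percSeq d p := fun y => by
    rw [laceEvent_succ, vertexSeq_last, hwy, hby, hLy]
    exact setLIntegral_laceEvent_inter p n (vertexSeq u x) w b (B := fun A => E' w y A) (hEm y)
      (measurable_perc_throughConn p y w x)
  have hm2 : ∀ y, Measurable fun ω : ℕ → Config d => perc d p (E' w y (modCluster w b (ω n))) :=
    fun y => (measurable_perc_of_joint p (hEm y)).comp hmC
  have hm3 : ∀ y, Measurable fun ω : ℕ → Config d => ∫⁻ η in E' w y (modCluster w b (ω n)),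
      perc d p (throughConn (modCluster y w η) y x) ∂perc d p := fun y => by
    classical
    have : Measurable fun A : Config d => ∫⁻ η, (if η ∈ E' w y A then
        perc d p (throughConn (modCluster y w η) y x) else 0) ∂perc d p := by
      refine Measurable.lintegral_prod_right' (f := fun q : Config d × Config d =>
        if q.2 ∈ E' w y q.1 then perc d p (throughConn (modCluster y w q.2) y x) else 0) ?_
      exact Measurable.ite (measurableSet_setOfPred.2 (hEm y))
        ((measurable_perc_throughConn p y w x).comp measurable_snd) measurable_const
    convert this.comp hmC using 2 with ω
    rw [Function.comp_apply, ← lintegral_indicator (measurableSet_E' _ _ _)]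
    simp [Set.indicator_apply]
  simp only [h1, h2, h3]
  have hm4 : ∀ y, Measurable fun ω : ℕ → Config d =>
      perc d p (E' w y (modCluster w b (ω n))) * etau p (x - y) := fun y =>
    (hm2 y).mul_const _
  have h4 : ∑' y, (∫⁻ ω in L, perc d p (E' w y (modCluster w b (ω n))) ∂percSeq d p) *
      etau p (x - y) = ∫⁻ ω in L, ∑' y, perc d p (E' w y (modCluster w b (ω n))) *
        etau p (x - y) ∂percSeq d p := by
    rw [lintegral_tsum fun y => (hm4 y).aemeasurable]
    exact tsum_congr fun y => (lintegral_mul_const _ (hm2 y)).symm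
  rw [h4, ← lintegral_tsum fun y => (hm3 y).aemeasurable,
    ← lintegral_const_mul _ (Measurable.tsum hm3),
    ← lintegral_const_mul _ (Measurable.tsum hm4),
    ← lintegral_add_right _ ((Measurable.tsum hm3).const_mul _),
    ← lintegral_add_left (hm2 x)]
  exact lintegral_congr fun ω => perc_throughConn_add hχ w x (modCluster w b (ω n))

/-! ### Balls -/

lemma norm1_nonneg (x : Site d) : 0 ≤ norm1 x := Finset.sum_nonneg fun _ _ => abs_nonneg _

lemma norm1_add_le (x y : Site d) : norm1 (x + y) ≤ norm1 x + norm1 y := by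
  rw [norm1, norm1, norm1, ← Finset.sum_add_distrib]
  exact Finset.sum_le_sum fun i _ => abs_add_le _ _

lemma abs_le_norm1 (x : Site d) (i : Fin d) : |x i| ≤ norm1 x :=
  Finset.single_le_sum (f := fun i => |x i|) (fun _ _ => abs_nonneg _) (Finset.mem_univ i)

lemma norm1_le_of_adj {x y : Site d} (h : Adj x y) : norm1 y ≤ norm1 x + 1 := by
  have := norm1_add_le x (y - x)
  rw [show norm1 (y - x) = 1 from h] at this
  simpa using this

/-- The ball of radius `n` for the `1`-norm. -/
def ball (d n : ℕ) : Finset (Site d) :=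
  (Finset.Icc (fun _ => -(n : ℤ)) (fun _ => (n : ℤ))).filter fun x => norm1 x ≤ n

lemma mem_ball {n : ℕ} {x : Site d} : x ∈ ball d n ↔ norm1 x ≤ n := by
  simp only [ball, Finset.mem_filter, Finset.mem_Icc, Pi.le_def, and_iff_right_iff_imp]
  intro h
  exact ⟨fun i => (abs_le.1 ((abs_le_norm1 x i).trans h)).1,
    fun i => (abs_le.1 ((abs_le_norm1 x i).trans h)).2⟩

lemma card_ball_le (d n : ℕ) : (ball d n).card ≤ (2 * n + 1) ^ d := by
  refine (Finset.card_filter_le _ _).trans (le_of_eq ?_)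
  rw [Pi.card_Icc]
  simp only [Int.card_Icc, Finset.prod_const, Finset.card_univ, Fintype.card_fin]
  congr 1
  omega

lemma exists_subset_ball {S : Set (Site d)} (hS : S.Finite) : ∃ n, S ⊆ ball d n := by
  obtain ⟨b, hb⟩ := (hS.image norm1).bddAbove
  refine ⟨b.toNat, fun x hx => mem_ball.2 ((hb ⟨x, hx, rfl⟩).trans (Int.self_le_toNat b))⟩

/-! ### Finite susceptibility from a finite-volume criterion -/

/-- `p` times the expected number of sites outside `S` that are connected to the origin in `S`. -/
def phi (p : unitInterval) (S : Set (Site d)) : ENNReal :=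
  ENNReal.ofReal p * ∑' y, Sᶜ.indicator (fun y => perc d p (connIn S 0 y)) y

/-- The sites reached from the origin through occupied sites of `S`. -/
def inCluster (S : Set (Site d)) (ω : Config d) : Set (Site d) := {y | Reach (ω ∩ S) 0 y}

lemma measurableSet_inCluster_eq (S C : Set (Site d)) :
    MeasurableSet {ω : Config d | inCluster S ω = C} := by
  refine measurableSet_eq_config (measurable_set_iff.2 fun y => ?_) C
  exact measurable_reach (measurable_inter_config measurable_id measurable_const) 0 y

lemma determinedBy_inCluster_eq (S C : Set (Site d)) :
    DeterminedBy {ω : Config d | inCluster S ω = C} (S ∩ thick C) := by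
  rintro ω ω' h rfl
  ext y
  constructor
  · intro hy
    refine Reach.rec_tail (motive := fun y => y ∈ inCluster S ω) hy (Reach.refl _ _) ?_
    intro b c _ hbc hc ih
    exact Reach.tail ih hbc ⟨(h c ⟨hc.2, mem_thick.2 (.inr ⟨b, ih, hbc⟩)⟩).1 hc.1, hc.2⟩
  · intro hy
    refine Reach.rec_tail (motive := fun y => y ∈ inCluster S ω') hy (Reach.refl _ _) ?_
    intro b c hb hbc hc ih
    exact Reach.tail ih hbc ⟨(h c ⟨hc.2, mem_thick.2 (.inl (hb.tail hbc hc))⟩).2 hc.1, hc.2⟩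

lemma exists_exit_of_conn {S : Set (Site d)} {x : Site d} (hx : x ∉ thick S) (h0 : 0 ∈ S)
    {ω : Config d} (h : ω ∈ conn 0 x) :
    ∃ y ∉ S, (∃ z ∈ inCluster S ω, Adj z y) ∧ y ∈ ω ∧
      Joined (ω ∩ (S ∩ thick (inCluster S ω))ᶜ) y x := by
  set C := inCluster S ω with hC
  have h0C : (0 : Site d) ∈ C := Reach.refl _ _
  have hCS : C ⊆ S := fun a ha => by
    rcases Reach.eq_or_mem ha with rfl | ha
    exacts [h0, ha.2]
  have hxC : ∀ t ∈ C, t ≠ x := by rintro t ht rfl; exact hx (.inl (hCS ht))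
  obtain ⟨-, w, hw, hwx⟩ := joined_iff.1 h
  obtain ⟨t, htC, htw⟩ : ∃ t ∈ C, Reach (ω \ C) t w := by
    rcases hw.last_exit C with h | ⟨t, ht, -, -, h⟩
    exacts [⟨0, h0C, h⟩, ⟨t, ht, h⟩]
  have hsub : ω \ C ⊆ ω ∩ (S ∩ thick C)ᶜ := by
    rintro a ⟨ha, haC⟩
    refine ⟨ha, fun h => haC ?_⟩
    rcases mem_thick.1 h.2 with h' | ⟨z, hz, hza⟩
    · exact h'
    · exact Reach.tail hz hza ⟨ha, h.1⟩
  rcases Relation.ReflTransGen.cases_head htw with rfl | ⟨c, ⟨htc, hcω⟩, hcw⟩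
  · exact absurd (mem_thick.2 (.inr ⟨t, hCS htC, hwx⟩)) hx
  · have hcS : c ∉ S := fun h => hcω.2 (Reach.tail htC htc ⟨hcω.1, h⟩)
    have hcx : c ≠ x := by
      rintro rfl
      exact hx (mem_thick.2 (.inr ⟨t, hCS htC, htc⟩))
    exact ⟨c, hcS, ⟨t, htC, htc⟩, hcω.1, (Reach.mono hsub hcw).joined_of_adj hwx hcx⟩

lemma measurableSet_connIn (A : Set (Site d)) (u x : Site d) : MeasurableSet (connIn A u x) :=
  measurableSet_setOfPred.2
    (measurable_joined (measurable_inter_config measurable_id measurable_const) u x)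

lemma finite_inCluster {S : Set (Site d)} (hS : S.Finite) (ω : Config d) :
    (inCluster S ω).Finite :=
  (hS.insert 0).subset fun _ hy => (Reach.eq_or_mem hy).imp_right And.right

lemma etau_le_of_exit (p : unitInterval) {S : Set (Site d)} (hS : S.Finite) (h0 : 0 ∈ S)
    {x : Site d} (hx : x ∉ thick S) :
    etau p x ≤ ENNReal.ofReal p *
      ∑' y, Sᶜ.indicator (fun y => perc d p (connIn S 0 y)) y * etau p (x - y) := by
  classical
  let G : Site d → Finset (Site d) → Set (Config d) := fun y C =>
    if y ∉ S ∧ ∃ z ∈ C, Adj z y then {ω | inCluster S ω = C} else ∅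
  let H : Site d → Finset (Site d) → Set (Config d) := fun y C =>
    {ω | y ∈ ω} ∩ connIn (S ∩ thick C)ᶜ y x
  have hcov : conn 0 x ⊆ ⋃ y, ⋃ C, G y C ∩ H y C := by
    intro ω hω
    obtain ⟨y, hyS, hyC, hyω, hj⟩ := exists_exit_of_conn hx h0 hω
    have hfin := finite_inCluster hS ω
    refine Set.mem_iUnion.2 ⟨y, Set.mem_iUnion.2 ⟨hfin.toFinset, ?_, hyω, ?_⟩⟩
    · simp only [G]
      rw [if_pos ⟨hyS, by simpa using hyC⟩]
      simp
    · simpa [connIn] using hj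
  have hGm : ∀ y C, MeasurableSet (G y C) := fun y C => by
    simp only [G]
    split_ifs
    exacts [measurableSet_inCluster_eq _ _, .empty]
  have hGH : ∀ y C, perc d p (G y C ∩ H y C) ≤
      perc d p (G y C) * (ENNReal.ofReal p * etau p (x - y)) := by
    intro y C
    by_cases hyC : y ∉ S ∧ ∃ z ∈ C, Adj z y
    · have hG : G y C = {ω | inCluster S ω = C} := if_pos hyC
      have hH : perc d p (H y C) ≤ ENNReal.ofReal p * etau p (x - y) := by
        simp only [H]
        rw [perc_inter p (S := {y}) (measurableSet_occupied y) (measurableSet_connIn _ _ _)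
          (determinedBy_occupied y) ((determinedBy_connIn _ _ _).mono fun a ha => ha.2),
          perc_occupied, ← perc_conn]
        exact mul_le_mul_right (measure_mono fun ω hω => Joined.mono Set.inter_subset_left hω) _
      rw [hG, perc_inter p (S := S ∩ thick C) (measurableSet_inCluster_eq _ _)
        ((measurableSet_occupied y).inter (measurableSet_connIn _ _ _))
        (determinedBy_inCluster_eq S C)]
      · exact mul_le_mul_right hH _
      · refine DeterminedBy.inter ((determinedBy_occupied y).mono ?_)
          ((determinedBy_connIn _ _ _).mono fun a ha => ha.1)
        rintro a rfl ha
        exact hyC.1 ha.1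
    · have hG : G y C = ∅ := if_neg hyC
      simp [hG]
  have hGsum : ∀ y, ∑' C, perc d p (G y C) ≤
      Sᶜ.indicator (fun y => perc d p (connIn S 0 y)) y := by
    intro y
    rw [← measure_iUnion _ (hGm y)]
    · by_cases hy : y ∈ S
      · have : ∀ C, G y C = ∅ := fun C => if_neg fun h => h.1 hy
        simp [this]
      · rw [Set.indicator_of_mem (show y ∈ Sᶜ from hy)]
        refine measure_mono (Set.iUnion_subset fun C ω hω => ?_)
        by_cases hyC : y ∉ S ∧ ∃ z ∈ C, Adj z y
        · simp only [G, if_pos hyC, Set.mem_ofPred_eq] at hω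
          obtain ⟨z, hz, hzy⟩ := hyC.2
          have hz' : z ∈ inCluster S ω := by rw [hω]; exact hz
          exact Reach.joined_of_adj hz' hzy (by rintro rfl; exact hy h0)
        · simp [G, if_neg hyC] at hω
    · intro C C' hCC
      refine Set.disjoint_left.2 fun ω h1 h2 => hCC ?_
      simp only [G] at h1 h2
      split_ifs at h1 h2
      · exact Finset.coe_injective ((show _ = _ from h1).symm.trans h2)
      all_goals simp_all
  calc etau p x ≤ perc d p (⋃ y, ⋃ C, G y C ∩ H y C) := measure_mono hcov
    _ ≤ ∑' y, ∑' C, perc d p (G y C ∩ H y C) :=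
      (measure_iUnion_le _).trans (ENNReal.tsum_le_tsum fun y => measure_iUnion_le _)
    _ ≤ ∑' y, ∑' C, perc d p (G y C) * (ENNReal.ofReal p * etau p (x - y)) :=
      ENNReal.tsum_le_tsum fun y => ENNReal.tsum_le_tsum fun C => hGH y C
    _ ≤ ∑' y, ENNReal.ofReal p *
        (Sᶜ.indicator (fun y => perc d p (connIn S 0 y)) y * etau p (x - y)) := by
      refine ENNReal.tsum_le_tsum fun y => ?_
      rw [ENNReal.tsum_mul_right, mul_left_comm]
      exact mul_le_mul_right (mul_le_mul_left (hGsum y) _) _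
    _ = _ := ENNReal.tsum_mul_left

lemma etau_le_phi_pow (p : unitInterval) {S : Set (Site d)} (h0 : 0 ∈ S) {M : ℕ}
    (hM : S ⊆ ball d M) (n : ℕ) (x : Site d) (hx : (n * (M + 2) : ℤ) ≤ norm1 x) :
    etau p x ≤ phi p S ^ n := by
  have hS : S.Finite := (ball d M).finite_toSet.subset hM
  have hthick : ∀ y ∈ thick S, norm1 y ≤ M + 1 := by
    intro y hy
    rcases mem_thick.1 hy with hy | ⟨z, hz, hzy⟩
    · exact (mem_ball.1 (hM hy)).trans (by omega)
    · have := mem_ball.1 (hM hz)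
      have := norm1_le_of_adj hzy
      omega
  induction n generalizing x with
  | zero => rw [pow_zero]; exact prob_le_one
  | succ n ih =>
    push_cast at hx
    have hxS : x ∉ thick S := fun h => by
      have := hthick x h
      nlinarith
    refine (etau_le_of_exit p hS h0 hxS).trans ?_
    rw [pow_succ', phi, mul_assoc, ← ENNReal.tsum_mul_right]
    refine mul_le_mul_right (ENNReal.tsum_le_tsum fun y => ?_) _
    by_cases hy : y ∈ thick S
    · refine mul_le_mul_right (ih (x - y) ?_) _
      have h1 := hthick y hy
      have h2 := norm1_add_le (x - y) y
      rw [sub_add_cancel] at h2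
      linarith
    · have : connIn S 0 y = ∅ := by
        refine Set.eq_empty_of_forall_notMem fun ω hω => hy ?_
        obtain ⟨-, z, hz, hzy⟩ := joined_iff.1 hω
        refine mem_thick.2 (.inr ⟨z, ?_, hzy⟩)
        rcases hz.eq_or_mem with rfl | hz
        exacts [h0, hz.2]
      by_cases hyS : y ∈ S <;> simp [this, hyS]

lemma tsum_etau_ne_top_of_phi_lt_one (p : unitInterval) {S : Set (Site d)} (hS : S.Finite)
    (h0 : 0 ∈ S) (hphi : phi p S < 1) : ∑' x : Site d, etau p x ≠ ⊤ := by
  classical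
  obtain ⟨M, hM⟩ := exists_subset_ball hS
  obtain ⟨r, hr, hr1⟩ := ENNReal.lt_iff_exists_nnreal_btwn.1 hphi
  have hr1' : (r : ℝ) < 1 := by exact_mod_cast hr1
  have hr0 : 0 < (r : ℝ) := by
    have : (0 : ENNReal) < r := (zero_le).trans_lt hr
    exact_mod_cast this
  set N := M + 2 with hN
  have hbound : ∀ x : Site d, etau p x ≤
      ∑' n : ℕ, if x ∈ ball d ((n + 1) * N) then (r : ENNReal) ^ n else 0 := by
    intro x
    let n := (norm1 x).toNat / N
    have hle : norm1 x ≤ ((n + 1) * N : ℕ) := by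
      have h1 : (norm1 x).toNat < N * (n + 1) := Nat.lt_mul_div_succ _ (by omega)
      have h2 := Int.self_le_toNat (norm1 x)
      rw [mul_comm]
      omega
    refine le_trans ?_ (ENNReal.le_tsum n)
    rw [if_pos (mem_ball.2 hle)]
    refine (etau_le_phi_pow p h0 hM n x ?_).trans (pow_le_pow_left' hr.le n)
    have h1 : n * N ≤ (norm1 x).toNat := Nat.div_mul_le_self _ _
    have h2 : ((norm1 x).toNat : ℤ) = norm1 x := Int.toNat_of_nonneg (norm1_nonneg x)
    rw [← h2]
    exact_mod_cast h1
  have hsummable : Summable fun n : ℕ =>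
      (3 * N : NNReal) ^ d * (((n + 1 : ℕ) : NNReal) ^ d * r ^ n) := by
    refine Summable.mul_left _ ?_
    have h1 : Summable fun n : ℕ => ((n : ℝ) ^ d * (r : ℝ) ^ n) :=
      summable_pow_mul_geometric_of_norm_lt_one d (by simpa using hr1')
    have h2 := ((summable_nat_add_iff 1).2 h1).mul_right (r : ℝ)⁻¹
    rw [← NNReal.summable_coe]
    refine h2.congr fun n => ?_
    push_cast
    rw [pow_succ]
    field_simp
  refine ne_top_of_le_ne_top (ENNReal.tsum_coe_ne_top_iff_summable.2 hsummable) ?_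
  refine (ENNReal.tsum_le_tsum hbound).trans ?_
  rw [ENNReal.tsum_comm]
  refine ENNReal.tsum_le_tsum fun n => ?_
  rw [tsum_eq_sum (s := ball d ((n + 1) * N)) (fun x hx => if_neg hx),
    Finset.sum_congr rfl (fun x hx => if_pos hx), Finset.sum_const, nsmul_eq_mul]
  have hcard : ((ball d ((n + 1) * N)).card : NNReal) ≤
      (3 * N : NNReal) ^ d * ((n + 1 : ℕ)) ^ d := by
    rw [← mul_pow]
    have h1 := card_ball_le d ((n + 1) * N)
    have h2 : 2 * ((n + 1) * N) + 1 ≤ 3 * N * (n + 1) := by nlinarith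
    exact_mod_cast h1.trans (Nat.pow_le_pow_left h2 d)
  rw [← mul_assoc, ENNReal.coe_mul, ENNReal.coe_pow]
  refine mul_le_mul_left ?_ _
  exact_mod_cast hcard

/-! ### The formula of Russo -/

/-- The probability that the configuration in `Λ` is `η`. -/
def weight (Λ η : Finset (Site d)) (q : ℝ) : ℝ := ∏ i ∈ Λ, if i ∈ η then q else 1 - q

open Classical in
/-- The probability, as a polynomial in `q`, of an event that depends on the sites in `Λ`. -/
def cylProb (Λ : Finset (Site d)) (A : Set (Config d)) (q : ℝ) : ℝ :=
  ∑ η ∈ Λ.powerset, if (η : Config d) ∈ A then weight Λ η q else 0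

lemma measurableSet_cyl (η : Config d) (Λ : Finset (Site d)) :
    MeasurableSet (cyl η (Λ : Set (Site d))) :=
  measurableSet_setOfPred.2 (Measurable.forall fun y => measurable_const.imp
    ((measurable_mem_config measurable_id y).iff measurable_const))

lemma perc_real_cyl (p : unitInterval) (Λ η : Finset (Site d)) :
    (perc d p).real (cyl (η : Config d) (Λ : Set (Site d))) = weight Λ η p := by
  classical
  rw [measureReal_def, ← (measurePreserving_setOfPred d p).measure_preimage
    (measurableSet_cyl _ Λ).nullMeasurableSet]
  have : (fun P : Site d → Prop => ({i | P i} : Config d)) ⁻¹'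
      cyl (η : Config d) (Λ : Set (Site d)) =
      (Λ : Set (Site d)).pi fun i => if i ∈ η then {True} else {False} := by
    ext P
    simp only [cyl, Set.mem_preimage, Set.mem_ofPred_eq, Set.mem_pi, Finset.mem_coe]
    refine forall₂_congr fun i _ => ?_
    by_cases hi : i ∈ η <;> simp [hi]
  rw [this, Measure.infinitePi_pi _ (by intro i _; split_ifs <;> exact measurableSet_singleton _),
    ENNReal.toReal_prod, weight]
  refine Finset.prod_congr rfl fun i _ => ?_
  have h0 := p.2.1
  have h1 : (0 : ℝ) ≤ 1 - p := by linarith [p.2.2]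
  by_cases hi : i ∈ η <;> simp [hi, siteLaw_apply, h0, h1]

lemma perc_real_eq_cylProb (p : unitInterval) {Λ : Finset (Site d)} {A : Set (Config d)}
    (hA : DeterminedBy A Λ) : (perc d p).real A = cylProb Λ A p := by
  classical
  have hset : A = ⋃ η ∈ Λ.powerset.filter (fun η : Finset (Site d) => (η : Config d) ∈ A),
      cyl (η : Config d) (Λ : Set (Site d)) := by
    ext ω
    simp only [Set.mem_iUnion, Finset.mem_filter, Finset.mem_powerset, exists_prop]
    constructor
    · intro hω
      refine ⟨Λ.filter (· ∈ ω), ⟨Finset.filter_subset _ _, hA ω _ ?_ hω⟩, ?_⟩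
      · intro y hy
        have : y ∈ Λ := hy
        simp [this]
      · intro y hy
        have : y ∈ Λ := hy
        simp [this]
    · rintro ⟨η, ⟨-, hη⟩, hω⟩
      exact hA _ ω hω hη
  conv_lhs => rw [hset]
  rw [measureReal_biUnion_finset _ (fun η _ => measurableSet_cyl _ Λ), cylProb, Finset.sum_filter]
  · simp only [perc_real_cyl]
  · intro η hη η' hη' hne
    refine Set.disjoint_left.2 fun ω h1 h2 => hne ?_
    simp only [Finset.coe_filter, Finset.mem_powerset, Set.mem_ofPred_eq] at hη hη'
    ext y
    by_cases hy : y ∈ Λ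
    · simpa using (h1 y hy).symm.trans (h2 y hy)
    · exact ⟨fun h => absurd (hη.1 h) hy, fun h => absurd (hη'.1 h) hy⟩

lemma hasDerivAt_weight (Λ η : Finset (Site d)) (q : ℝ) :
    HasDerivAt (weight Λ η)
      (∑ y ∈ Λ, weight (Λ.erase y) η q * if y ∈ η then 1 else -1) q := by
  have h : ∀ i ∈ Λ, HasDerivAt (fun q : ℝ => if i ∈ η then q else 1 - q)
      (if i ∈ η then 1 else -1) q := by
    intro i _
    by_cases hi : i ∈ η
    · simp only [hi, if_true]
      exact hasDerivAt_id' q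
    · simp only [hi, if_false]
      exact (hasDerivAt_id' q).const_sub 1
  exact HasDerivAt.fun_finsetProd h

/-- Increasing events. -/
def Increasing (A : Set (Config d)) : Prop := ∀ ω η : Config d, ω ⊆ η → ω ∈ A → η ∈ A

/-- The event that `y` is vacant and pivotal for `A`. -/
def vacantPiv (A : Set (Config d)) (y : Site d) : Set (Config d) := {ω | y ∈ piv A ω ∧ y ∉ ω}

lemma determinedBy_vacantPiv {A : Set (Config d)} {Λ : Finset (Site d)} (hA : DeterminedBy A Λ)
    {y : Site d} (hy : y ∈ Λ) : DeterminedBy (vacantPiv A y) Λ := by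
  rintro ω ω' h ⟨⟨h1, h2⟩, h3⟩
  refine ⟨⟨hA _ _ ?_ h1, fun h4 => h2 (hA _ _ ?_ h4)⟩, fun h4 => h3 ((h y hy).1 h4)⟩
  · intro z hz
    simp [h z hz]
  · intro z hz
    simp [h z hz]

lemma weight_erase_congr (Λ : Finset (Site d)) {y : Site d}
    (η : Finset (Site d)) (q : ℝ) : weight (Λ.erase y) (insert y η) q = weight (Λ.erase y) η q := by
  refine Finset.prod_congr rfl fun i hi => ?_
  have : i ≠ y := Finset.ne_of_mem_erase hi
  simp [this]

/-- The formula of Russo. -/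
lemma hasDerivAt_cylProb {A : Set (Config d)} (hmono : Increasing A) (Λ : Finset (Site d)) (q : ℝ) :
    ∃ D, HasDerivAt (cylProb Λ A) D q ∧ (1 - q) * D = ∑ y ∈ Λ, cylProb Λ (vacantPiv A y) q := by
  classical
  have hsum : ∀ y ∈ Λ, ∀ f : Finset (Site d) → ℝ, ∑ η ∈ Λ.powerset, f η =
      ∑ η ∈ (Λ.erase y).powerset, (f η + f (insert y η)) := by
    intro y hy f
    conv_lhs => rw [← Finset.insert_erase hy]
    rw [Finset.sum_powerset_insert (Finset.notMem_erase y Λ), Finset.sum_add_distrib]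
  refine ⟨∑ η ∈ Λ.powerset, if (η : Config d) ∈ A then
    ∑ y ∈ Λ, weight (Λ.erase y) η q * (if y ∈ η then 1 else -1) else 0, ?_, ?_⟩
  · unfold cylProb
    refine HasDerivAt.fun_sum fun η _ => ?_
    split_ifs
    · exact hasDerivAt_weight Λ η q
    · exact hasDerivAt_const q 0
  · have h1 : (∑ η ∈ Λ.powerset, if (η : Config d) ∈ A then
        ∑ y ∈ Λ, weight (Λ.erase y) η q * (if y ∈ η then 1 else -1) else 0) =
        ∑ y ∈ Λ, ∑ η ∈ Λ.powerset, if (η : Config d) ∈ A then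
          weight (Λ.erase y) η q * (if y ∈ η then 1 else -1) else 0 := by
      rw [Finset.sum_comm]
      refine Finset.sum_congr rfl fun η _ => ?_
      split_ifs <;> simp
    rw [h1, Finset.mul_sum]
    refine Finset.sum_congr rfl fun y hy => ?_
    rw [hsum y hy, cylProb, hsum y hy, Finset.mul_sum]
    refine Finset.sum_congr rfl fun η hη => ?_
    have hyη : y ∉ η := fun h => Finset.notMem_erase y Λ (Finset.mem_powerset.1 hη h)
    have hw : weight Λ η q = (1 - q) * weight (Λ.erase y) η q := by
      rw [weight, ← Finset.mul_prod_erase Λ _ hy, if_neg hyη, weight]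
    have hins : ((insert y η : Finset (Site d)) : Config d) ∉ vacantPiv A y := fun h =>
      h.2 (by simp)
    have hpiv : (η : Config d) ∈ vacantPiv A y ↔
        ((insert y η : Finset (Site d)) : Config d) ∈ A ∧ (η : Config d) ∉ A := by
      have e1 : (η : Config d) ∪ {y} = ((insert y η : Finset (Site d)) : Config d) := by
        ext z; simp
      have e2 : (η : Config d) \ {y} = (η : Config d) := by
        ext z
        simp only [Set.mem_sdiff, Finset.mem_coe, Set.mem_singleton_iff, and_iff_left_iff_imp]
        rintro hz rfl
        exact hyη hz
      simp only [vacantPiv, piv, Set.mem_ofPred_eq, e1, e2]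
      exact ⟨fun h => h.1, fun h => ⟨h, by simpa using hyη⟩⟩
    have hm : (η : Config d) ∈ A → ((insert y η : Finset (Site d)) : Config d) ∈ A :=
      hmono _ _ (by simp)
    rw [if_neg hins, weight_erase_congr, if_neg hyη, if_pos (Finset.mem_insert_self y η)]
    by_cases ha : (η : Config d) ∈ A
    · have hb := hm ha
      have : (η : Config d) ∉ vacantPiv A y := fun h => (hpiv.1 h).2 ha
      rw [if_pos ha, if_pos hb, if_neg this]
      ring
    · by_cases hb : ((insert y η : Finset (Site d)) : Config d) ∈ A
      · rw [if_neg ha, if_pos hb, if_pos (hpiv.2 ⟨hb, ha⟩), hw]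
        ring
      · have : (η : Config d) ∉ vacantPiv A y := fun h => hb (hpiv.1 h).1
        rw [if_neg ha, if_neg hb, if_neg this]
        ring

lemma cylProb_eq_perc {Λ : Finset (Site d)} {A : Set (Config d)} (hA : DeterminedBy A Λ) {q : ℝ}
    (h0 : 0 ≤ q) (h1 : q ≤ 1) : cylProb Λ A q = (perc d ⟨q, h0, h1⟩).real A :=
  (perc_real_eq_cylProb ⟨q, h0, h1⟩ hA).symm

lemma continuousOn_cylProb {A : Set (Config d)} (hmono : Increasing A) (Λ : Finset (Site d))
    (s : Set ℝ) : ContinuousOn (cylProb Λ A) s := fun q _ =>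
  (hasDerivAt_cylProb hmono Λ q).choose_spec.1.continuousAt.continuousWithinAt

lemma perc_mono {p p' : unitInterval} (hpp : p ≤ p') {Λ : Finset (Site d)} {A : Set (Config d)}
    (hA : DeterminedBy A Λ) (hmono : Increasing A) : perc d p A ≤ perc d p' A := by
  have hM : MonotoneOn (cylProb Λ A) (Set.Icc 0 1) := by
    refine monotoneOn_of_deriv_nonneg (convex_Icc 0 1) (continuousOn_cylProb hmono Λ _) ?_ ?_
    · exact fun q _ =>
        (hasDerivAt_cylProb hmono Λ q).choose_spec.1.differentiableAt.differentiableWithinAt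
    · intro q hq
      rw [interior_Icc] at hq
      obtain ⟨D, hD, hD'⟩ := hasDerivAt_cylProb hmono Λ q
      rw [hD.deriv]
      have : 0 ≤ (1 - q) * D := by
        rw [hD']
        refine Finset.sum_nonneg fun y hy => ?_
        rw [cylProb_eq_perc (determinedBy_vacantPiv hA hy) hq.1.le hq.2.le]
        exact measureReal_nonneg
      exact nonneg_of_mul_nonneg_right this (by linarith [hq.2])
  have := hM p.2 p'.2 hpp
  rw [← perc_real_eq_cylProb p hA, ← perc_real_eq_cylProb p' hA] at this
  exact (ENNReal.toReal_le_toReal (measure_ne_top _ _) (measure_ne_top _ _)).1 this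

/-! ### Sharpness of the phase transition -/

/-- The event that the origin is connected to the complement of `Λ`. -/
def exitEvent (Λ : Set (Site d)) : Set (Config d) := {ω | ∃ z, z ∉ Λ ∧ Joined (ω ∩ Λ) 0 z}

/-- The sites of `Λ` that are not connected to the complement of `Λ`. -/
def trapped (Λ : Set (Site d)) (ω : Config d) : Set (Site d) :=
  {y | y ∈ Λ ∧ ¬ ∃ z, z ∉ Λ ∧ Joined (ω ∩ Λ) y z}

lemma increasing_connIn (S : Set (Site d)) (u x : Site d) : Increasing (connIn S u x) :=
  fun _ _ h hω => Joined.mono (Set.inter_subset_inter_left S h) hω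

lemma increasing_exitEvent (Λ : Set (Site d)) : Increasing (exitEvent Λ) := by
  rintro ω ω' h ⟨z, hz, hj⟩
  exact ⟨z, hz, hj.mono (Set.inter_subset_inter_left Λ h)⟩

lemma determinedBy_exitEvent (Λ : Set (Site d)) : DeterminedBy (exitEvent Λ) Λ := by
  rintro ω ω' h ⟨z, hz, hj⟩
  exact ⟨z, hz, hj.mono fun a ha => ⟨(h a ha.2).2 ha.1, ha.2⟩⟩

lemma measurableSet_exitEvent (Λ : Set (Site d)) : MeasurableSet (exitEvent Λ) :=
  measurableSet_setOfPred.2 (Measurable.exists fun z => measurable_const.and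
    (measurable_joined (measurable_inter_config measurable_id measurable_const) 0 z))

lemma measurableSet_trapped_eq (Λ S : Set (Site d)) :
    MeasurableSet {ω : Config d | trapped Λ ω = S} := by
  refine measurableSet_eq_config (measurable_set_iff.2 fun y => measurable_const.and
    (Measurable.not (Measurable.exists fun z => measurable_const.and ?_))) S
  exact measurable_joined (measurable_inter_config measurable_id measurable_const) y z

lemma zero_mem_trapped {Λ : Set (Site d)} (h0 : 0 ∈ Λ) {ω : Config d} :
    0 ∈ trapped Λ ω ↔ ω ∉ exitEvent Λ := by
  simp [trapped, exitEvent, h0]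

/-- A path that leaves `Λ` can be taken outside the set of trapped sites after its last visit. -/
lemma reach_sdiff_trapped {Λ : Set (Site d)} {ω : Config d} {y z w : Site d} (hz : z ∉ Λ)
    (h : Reach (ω ∩ Λ) y w) (hwz : Adj w z) : Reach ((ω ∩ Λ) \ trapped Λ ω) y w := by
  rcases h.last_exit (trapped Λ ω) with h | ⟨t, ht, -, -, h⟩
  · exact h
  · exact absurd ⟨z, hz, (h.mono Set.sdiff_subset).joined_of_adj hwz
      (by rintro rfl; exact hz ht.1)⟩ ht.2

lemma determinedBy_trapped_eq (Λ S : Set (Site d)) :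
    DeterminedBy {ω : Config d | trapped Λ ω = S} Sᶜ := by
  rintro ω ω' h rfl
  ext y
  refine and_congr_right fun hyΛ => not_congr ⟨?_, ?_⟩
  · rintro ⟨z, hz, hj⟩
    obtain ⟨hyz, w, hw, hwz⟩ := joined_iff.1 hj
    have hsub : (ω' ∩ Λ) \ trapped Λ ω ⊆ ω ∩ Λ := fun a ha => ⟨(h a ha.2).1 ha.1.1, ha.1.2⟩
    rcases hw.last_exit (trapped Λ ω) with h' | ⟨t, ht, -, -, h'⟩
    · exact ⟨z, hz, (h'.mono hsub).joined_of_adj hwz hyz⟩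
    · exact absurd ⟨z, hz, (h'.mono hsub).joined_of_adj hwz (by rintro rfl; exact hz ht.1)⟩ ht.2
  · rintro ⟨z, hz, hj⟩
    obtain ⟨hyz, w, hw, hwz⟩ := joined_iff.1 hj
    refine ⟨z, hz, (Reach.mono ?_ (reach_sdiff_trapped hz hw hwz)).joined_of_adj hwz hyz⟩
    exact fun a ha => ⟨(h a ha.2).2 ha.1.1, ha.1.2⟩

/-- A site connected to the origin inside the set of trapped sites is vacant and pivotal. -/
lemma mem_vacantPiv_of_trapped {Λ : Set (Site d)} {ω : Config d} {y : Site d}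
    (h0 : 0 ∈ trapped Λ ω) (hy : y ∉ trapped Λ ω) (hj : Joined (ω ∩ trapped Λ ω) 0 y) :
    y ∈ Λ ∧ ω ∈ vacantPiv (exitEvent Λ) y := by
  have h0' : ω ∉ exitEvent Λ := (zero_mem_trapped h0.1).1 h0
  have hj' : Joined (ω ∩ Λ) 0 y := hj.mono fun a ha => ⟨ha.1, ha.2.1⟩
  have hyΛ : y ∈ Λ := by
    by_contra hyΛ
    exact h0' ⟨y, hyΛ, hj'⟩
  obtain ⟨z, hz, hyz⟩ : ∃ z, z ∉ Λ ∧ Joined (ω ∩ Λ) y z := by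
    by_contra hcon
    exact hy ⟨hyΛ, hcon⟩
  have hin : ω ∪ {y} ∈ exitEvent Λ := by
    have hsub : ω ∩ Λ ⊆ (ω ∪ {y}) ∩ Λ := Set.inter_subset_inter_left Λ Set.subset_union_left
    refine ⟨z, hz, ((hj'.mono hsub).reach ⟨.inr rfl, hyΛ⟩).trans_joined (hyz.mono hsub) ?_⟩
    rintro rfl
    exact hz h0.1
  refine ⟨hyΛ, ⟨hin, fun h => h0' (increasing_exitEvent Λ _ _ Set.sdiff_subset h)⟩,
    fun hyω => h0' ?_⟩
  rwa [Set.union_eq_self_of_subset_right (Set.singleton_subset_iff.2 hyω)] at hin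

lemma perc_compl_exitEvent_le (p : unitInterval) {Λ : Finset (Site d)} (h0 : 0 ∈ Λ)
    (hphi : ∀ S : Set (Site d), S.Finite → 0 ∈ S → 1 ≤ phi p S) :
    perc d p (exitEvent (Λ : Set (Site d)))ᶜ ≤
      ENNReal.ofReal p * ∑ y ∈ Λ, perc d p (vacantPiv (exitEvent (Λ : Set (Site d))) y) := by
  classical
  set A := exitEvent (Λ : Set (Site d)) with hA
  let Q : Finset (Finset (Site d)) := Λ.powerset.filter (0 ∈ ·)
  have hcompl : Aᶜ = ⋃ S ∈ Q, {ω | trapped (Λ : Set (Site d)) ω = S} := by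
    ext ω
    simp only [Set.mem_iUnion, Set.mem_ofPred_eq, exists_prop, Q, Finset.mem_filter,
      Finset.mem_powerset]
    rw [Set.mem_compl_iff, hA, ← zero_mem_trapped (Finset.mem_coe.2 h0)]
    have hfin : (trapped (Λ : Set (Site d)) ω).Finite := Λ.finite_toSet.subset fun y hy => hy.1
    constructor
    · intro h
      refine ⟨hfin.toFinset, ⟨?_, by simpa using h⟩, by simp⟩
      intro y hy
      exact (hfin.mem_toFinset.1 hy).1
    · rintro ⟨S, ⟨-, hS⟩, h⟩
      rw [h]
      exact hS
  have hdisj : Set.PairwiseDisjoint (Q : Set (Finset (Site d)))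
      fun S => {ω : Config d | trapped (Λ : Set (Site d)) ω = S} := by
    intro S _ S' _ hne
    refine Set.disjoint_left.2 fun ω h1 h2 => hne ?_
    exact Finset.coe_injective ((show _ = _ from h1).symm.trans h2)
  have hSm : ∀ S : Finset (Site d),
      MeasurableSet {ω : Config d | trapped (Λ : Set (Site d)) ω = S} :=
    fun S => measurableSet_trapped_eq _ _
  have hterm : ∀ S ∈ Q, perc d p {ω | trapped (Λ : Set (Site d)) ω = S} ≤
      ENNReal.ofReal p * ∑ y ∈ Λ, perc d p
        (vacantPiv A y ∩ {ω | trapped (Λ : Set (Site d)) ω = S}) := by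
    intro S hS
    have h0S : 0 ∈ S := (Finset.mem_filter.1 hS).2
    have hle : ∀ y, (S : Set (Site d))ᶜ.indicator (fun y => perc d p (connIn S 0 y)) y *
        perc d p {ω | trapped (Λ : Set (Site d)) ω = S} ≤
        (Λ : Set (Site d)).indicator (fun y => perc d p
          (vacantPiv A y ∩ {ω | trapped (Λ : Set (Site d)) ω = S})) y := by
      intro y
      by_cases hy : y ∈ S
      · simp [hy]
      rw [Set.indicator_of_mem (show y ∈ (S : Set (Site d))ᶜ from hy),
        ← perc_inter p (S := S) (measurableSet_connIn _ _ _) (hSm S)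
          ((determinedBy_connIn _ _ _).mono Set.sdiff_subset) (determinedBy_trapped_eq _ _)]
      have key : ∀ ω ∈ connIn (S : Set (Site d)) 0 y ∩ {ω | trapped (Λ : Set (Site d)) ω = S},
          y ∈ (Λ : Set (Site d)) ∧ ω ∈ vacantPiv A y := by
        rintro ω ⟨h1, h2⟩
        have h2' : trapped (Λ : Set (Site d)) ω = S := h2
        exact mem_vacantPiv_of_trapped (by rw [h2']; exact h0S) (by rw [h2']; exact hy)
          (by rw [h2']; exact h1)
      by_cases hyΛ : y ∈ (Λ : Set (Site d))
      · rw [Set.indicator_of_mem hyΛ]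
        exact measure_mono fun ω hω => ⟨(key ω hω).2, hω.2⟩
      · rw [Set.eq_empty_of_forall_notMem fun ω hω => hyΛ (key ω hω).1]
        simp
    calc perc d p {ω | trapped (Λ : Set (Site d)) ω = S}
        ≤ phi p (S : Set (Site d)) * perc d p {ω | trapped (Λ : Set (Site d)) ω = S} :=
          le_mul_of_one_le_left' (hphi S S.finite_toSet h0S)
      _ ≤ ENNReal.ofReal p * ∑' y, (Λ : Set (Site d)).indicator (fun y => perc d p
          (vacantPiv A y ∩ {ω | trapped (Λ : Set (Site d)) ω = S})) y := by
          rw [phi, mul_assoc, ← ENNReal.tsum_mul_right]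
          exact mul_le_mul_right (ENNReal.tsum_le_tsum hle) _
      _ = _ := by
          rw [tsum_eq_sum (s := Λ) (fun y hy => Set.indicator_of_notMem (by simpa using hy) _)]
          congr 1
          exact Finset.sum_congr rfl fun y hy =>
            Set.indicator_of_mem (Finset.mem_coe.2 hy) _
  rw [hcompl, measure_biUnion_finset hdisj fun S _ => hSm S]
  refine (Finset.sum_le_sum hterm).trans ?_
  rw [← Finset.mul_sum, Finset.sum_comm]
  refine mul_le_mul_right (Finset.sum_le_sum fun y _ => ?_) _
  rw [Finset.sum_congr rfl fun S _ => by
    rw [Set.inter_comm, ← Measure.restrict_apply (hSm S)]]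
  rw [← measure_biUnion_finset hdisj fun S _ => hSm S]
  exact (measure_mono (Set.subset_univ _)).trans (by rw [Measure.restrict_apply_univ])

lemma phi_mono {p p' : unitInterval} (hpp : p ≤ p') {S : Set (Site d)} (hS : S.Finite) :
    phi p S ≤ phi p' S := by
  refine mul_le_mul' (ENNReal.ofReal_le_ofReal hpp) (ENNReal.tsum_le_tsum fun y => ?_)
  refine Set.indicator_le_indicator ?_
  refine perc_mono hpp (Λ := hS.toFinset) ((determinedBy_connIn S 0 y).mono ?_)
    (increasing_connIn S 0 y)
  simp

lemma exitEvent_real_ge {p p' : unitInterval} (hpp : p ≤ p') (hp' : (p' : ℝ) < 1)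
    (hphi : ∀ S : Set (Site d), S.Finite → 0 ∈ S → 1 ≤ phi p S) {Λ : Finset (Site d)}
    (h0 : 0 ∈ Λ) :
    1 - Real.exp (p - p') ≤ (perc d p').real (exitEvent (Λ : Set (Site d))) := by
  set A := exitEvent (Λ : Set (Site d)) with hA
  have hmono : Increasing A := increasing_exitEvent _
  have hdet : DeterminedBy A Λ := determinedBy_exitEvent _
  have hp0 : (0 : ℝ) ≤ p := p.2.1
  have hderiv := fun q => hasDerivAt_cylProb hmono Λ q
  choose D hD hD' using hderiv
  have hG : ∀ q, HasDerivAt (fun q => (1 - cylProb Λ A q) * Real.exp q)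
      ((0 - D q) * Real.exp q + (1 - cylProb Λ A q) * Real.exp q) q := fun q =>
    ((hasDerivAt_const q 1).sub (hD q)).mul (Real.hasDerivAt_exp q)
  have hanti : AntitoneOn (fun q => (1 - cylProb Λ A q) * Real.exp q) (Set.Icc (p : ℝ) p') := by
    refine antitoneOn_of_deriv_nonpos (convex_Icc _ _)
      (fun q _ => (hG q).continuousAt.continuousWithinAt)
      (fun q _ => (hG q).differentiableAt.differentiableWithinAt) fun q hq => ?_
    rw [interior_Icc] at hq
    rw [(hG q).deriv]
    have hq0 : 0 < q := hp0.trans_lt hq.1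
    have hq1 : q < 1 := hq.2.trans hp'
    let q' : unitInterval := ⟨q, hq0.le, hq1.le⟩
    have hle := perc_compl_exitEvent_le q' h0 fun S hS h0S =>
      (hphi S hS h0S).trans (phi_mono (show p ≤ q' from hq.1.le) hS)
    have hle' : 1 - cylProb Λ A q ≤ q * ((1 - q) * D q) := by
      have h1 := ENNReal.toReal_mono (by
        refine ENNReal.mul_ne_top ENNReal.ofReal_ne_top (ENNReal.sum_ne_top.2 fun y _ => ?_)
        exact measure_ne_top _ _) hle
      rw [ENNReal.toReal_mul, ENNReal.toReal_ofReal q'.2.1,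
        ENNReal.toReal_sum (fun y _ => measure_ne_top _ _), ← measureReal_def,
        probReal_compl_eq_one_sub (measurableSet_exitEvent _)] at h1
      rw [hD', cylProb_eq_perc hdet hq0.le hq1.le]
      refine h1.trans (le_of_eq ?_)
      congr 1
      refine Finset.sum_congr rfl fun y hy => ?_
      rw [cylProb_eq_perc (determinedBy_vacantPiv hdet hy) hq0.le hq1.le]
      rfl
    have hF1 : 0 ≤ 1 - cylProb Λ A q := by
      rw [cylProb_eq_perc hdet hq0.le hq1.le]
      linarith [measureReal_le_one (μ := perc d ⟨q, hq0.le, hq1.le⟩) (s := A)]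
    have hDq : 1 - cylProb Λ A q ≤ D q := by
      have hpos : 0 < q * (1 - q) := mul_pos hq0 (by linarith)
      have hqq : q * (1 - q) ≤ 1 := by nlinarith
      have hD0 : 0 ≤ D q := by
        by_contra hneg
        nlinarith
      nlinarith
    have : (0 - D q) * Real.exp q + (1 - cylProb Λ A q) * Real.exp q =
        -((D q - (1 - cylProb Λ A q)) * Real.exp q) := by ring
    rw [this]
    exact neg_nonpos.2 (mul_nonneg (by linarith) (Real.exp_pos q).le)
  have h := hanti (Set.left_mem_Icc.2 hpp) (Set.right_mem_Icc.2 hpp) hpp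
  simp only at h
  rw [← perc_real_eq_cylProb p hdet, ← perc_real_eq_cylProb p' hdet] at h
  have hexp : Real.exp (p - p') * Real.exp p' = Real.exp p := by rw [← Real.exp_add]; simp
  have h0A : 0 ≤ (perc d p).real A := measureReal_nonneg
  have : (1 - (perc d p').real A) * Real.exp p' ≤ Real.exp (p - p') * Real.exp p' := by
    rw [hexp]
    refine h.trans ?_
    nlinarith [Real.exp_pos (p : ℝ)]
  have := le_of_mul_le_mul_right this (Real.exp_pos _)
  linarith

lemma exitEvent_anti {Λ Λ' : Set (Site d)} (h : Λ ⊆ Λ') (h0 : 0 ∈ Λ) :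
    exitEvent Λ' ⊆ exitEvent Λ := by
  rintro ω ⟨z, hz, hj⟩
  have hsub : (ω ∩ Λ') \ Λᶜ ⊆ ω ∩ Λ := fun a ha => ⟨ha.1.1, not_not.1 ha.2⟩
  rcases hj.first_hit Λᶜ with h' | ⟨a, t, ha, hat, ht, -⟩
  · exact ⟨z, fun hzΛ => hz (h hzΛ), h'.mono hsub⟩
  · exact ⟨t, ht, (ha.mono hsub).joined_of_adj hat (by rintro rfl; exact ht h0)⟩

lemma theta_pos_of_phi {p p' : unitInterval} (hpp : p < p') (hp' : (p' : ℝ) < 1)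
    (hphi : ∀ S : Set (Site d), S.Finite → 0 ∈ S → 1 ≤ phi p S) : 0 < theta d p' := by
  have h0 : ∀ n, (0 : Site d) ∈ ball d n := fun n => mem_ball.2 (by simp [norm1])
  have hanti : Antitone fun n => exitEvent (ball d n : Set (Site d)) := fun m n hmn =>
    exitEvent_anti (fun x hx => mem_ball.2 ((mem_ball.1 hx).trans (by exact_mod_cast hmn)))
      (h0 m)
  have hlim := tendsto_measure_iInter_atTop (μ := perc d p')
    (fun n => (measurableSet_exitEvent (ball d n : Set (Site d))).nullMeasurableSet) hanti
    ⟨0, measure_ne_top _ _⟩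
  have hge : ENNReal.ofReal (1 - Real.exp (p - p')) ≤
      perc d p' (⋂ n, exitEvent (ball d n : Set (Site d))) := by
    refine ge_of_tendsto' hlim fun n => ?_
    rw [Function.comp_apply, ← ofReal_measureReal]
    exact ENNReal.ofReal_le_ofReal (exitEvent_real_ge hpp.le hp' hphi (h0 n))
  have hpos : 0 < 1 - Real.exp ((p : ℝ) - p') := by
    have : (p : ℝ) < p' := hpp
    have := Real.exp_lt_exp.2 (show (p : ℝ) - p' < 0 by linarith)
    rw [Real.exp_zero] at this
    linarith
  have hsub : (⋂ n, exitEvent (ball d n : Set (Site d))) ⊆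
      {ω | (cluster ω (0 : Site d)).Infinite} := by
    intro ω hω hfin
    obtain ⟨n, hn⟩ := exists_subset_ball hfin
    obtain ⟨z, hz, hj⟩ := Set.mem_iInter.1 hω (n + 1)
    obtain ⟨-, w, hw, hwz⟩ := joined_iff.1 hj
    have h1 := mem_ball.1 (hn (mem_cluster.2 (hw.mono Set.inter_subset_left)))
    have h2 := norm1_le_of_adj hwz
    exact hz (mem_ball.2 (by push_cast; linarith))
  rw [theta, measureReal_def, ENNReal.toReal_pos_iff]
  exact ⟨(ENNReal.ofReal_pos.2 hpos).trans_le (hge.trans (measure_mono hsub)), measure_lt_top _ _⟩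

/-- The susceptibility is finite below the critical point. -/
theorem tsum_etau_ne_top_of_lt_pc {p : unitInterval} (hp : (p : ℝ) < pc d) :
    ∑' x : Site d, etau p x ≠ ⊤ := by
  by_contra htop
  have hphi : ∀ S : Set (Site d), S.Finite → 0 ∈ S → 1 ≤ phi p S := fun S hS h0 => by
    by_contra hlt
    exact tsum_etau_ne_top_of_phi_lt_one p hS h0 (not_le.1 hlt) htop
  have hbdd : BddBelow {q : ℝ | ∃ p : unitInterval, (p : ℝ) = q ∧ 0 < q ∧ 0 < theta d p} :=
    ⟨0, fun q hq => hq.choose_spec.2.1.le⟩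
  have hpc1 : pc d ≤ 1 := by
    by_cases hne : {q : ℝ | ∃ p : unitInterval, (p : ℝ) = q ∧ 0 < q ∧ 0 < theta d p}.Nonempty
    · obtain ⟨q, hq⟩ := hne
      exact (csInf_le hbdd hq).trans (hq.choose_spec.1 ▸ hq.choose.2.2)
    · rw [Set.not_nonempty_iff_eq_empty] at hne
      rw [pc, hne, Real.sInf_empty]
      exact zero_le_one
  have hp0 : (0 : ℝ) ≤ p := p.2.1
  let p' : unitInterval := ⟨(p + pc d) / 2, by linarith, by linarith⟩
  have hθ := theta_pos_of_phi (d := d) (p := p) (p' := p')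
    (show (p : ℝ) < (p + pc d) / 2 by linarith) (show (p + pc d) / 2 < 1 by linarith) hphi
  have hle : pc d ≤ (p + pc d) / 2 :=
    csInf_le hbdd ⟨p', rfl, by linarith, hθ⟩
  linarith

/-! ### The lace expansion -/

lemma etau_ne_top (p : unitInterval) (x : Site d) : etau p x ≠ ⊤ := measure_ne_top _ _

lemma laceSum_ne_top {p : unitInterval} (hχ : ∑' y : Site d, etau p y ≠ ⊤) (m : ℕ) (x : Site d) :
    laceSum p m x ≠ ⊤ :=
  ENNReal.ne_top_of_tsum_ne_top (tsum_laceSum_ne_top hχ m) x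

lemma remSum_ne_top {p : unitInterval} (hχ : ∑' y : Site d, etau p y ≠ ⊤) (n : ℕ) (x : Site d) :
    remSum p n x ≠ ⊤ :=
  ne_top_of_le_ne_top (tsum_laceSum_mul_etau_ne_top hχ n x) (remSum_le p n x)

lemma J_add_PiSum (p : unitInterval) (n : ℕ) (y : Site d) :
    J y + PiSum p n y = ∑ m ∈ Finset.range (n + 1), (-(p : ℝ)) ^ m * (laceSum p m y).toReal := by
  have hcoeff : ∀ m, (-1 : ℝ) ^ (m + 1) * PiCoeff p (m + 1) y =
      (-(p : ℝ)) ^ (m + 1) * (laceSum p (m + 1) y).toReal := fun m => by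
    rw [PiCoeff, laceSum, ENNReal.tsum_toReal_eq fun u => measure_ne_top _ _, neg_pow (p : ℝ),
      mul_assoc]
    rfl
  rw [PiSum, Finset.sum_range_succ', Finset.sum_range_succ',
    Finset.sum_congr rfl fun m _ => hcoeff m, laceSum_zero, PiCoeff, ← measureReal_def]
  ring

lemma summable_laceSum_mul_tau {p : unitInterval} (hχ : ∑' y : Site d, etau p y ≠ ⊤) (m : ℕ)
    (x : Site d) : Summable fun y => (laceSum p m y).toReal * tau p (x - y) := by
  have h := ENNReal.summable_toReal (tsum_laceSum_mul_etau_ne_top hχ m x)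
  simp only [ENNReal.toReal_mul] at h
  exact h

lemma toReal_tsum_laceSum_mul_etau {p : unitInterval} (hχ : ∑' y : Site d, etau p y ≠ ⊤) (m : ℕ)
    (x : Site d) : (∑' y, laceSum p m y * etau p (x - y)).toReal =
      ∑' y, (laceSum p m y).toReal * tau p (x - y) := by
  rw [ENNReal.tsum_toReal_eq fun y => ENNReal.mul_ne_top (laceSum_ne_top hχ m y) (etau_ne_top p _)]
  simp only [ENNReal.toReal_mul]
  rfl

lemma tau_add_remSum {p : unitInterval} (hχ : ∑' y : Site d, etau p y ≠ ⊤) (x : Site d) :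
    tau p x + p * (remSum p 0 x).toReal = (laceSum p 0 x).toReal +
      p * ∑' y, (laceSum p 0 y).toReal * tau p (x - y) := by
  have h := congrArg ENNReal.toReal (etau_add_remSum hχ x)
  rw [ENNReal.toReal_add (etau_ne_top p x)
      (ENNReal.mul_ne_top ENNReal.ofReal_ne_top (remSum_ne_top hχ 0 x)),
    ENNReal.toReal_add (laceSum_ne_top hχ 0 x)
      (ENNReal.mul_ne_top ENNReal.ofReal_ne_top (tsum_laceSum_mul_etau_ne_top hχ 0 x)),
    ENNReal.toReal_mul, ENNReal.toReal_mul, ENNReal.toReal_ofReal p.2.1,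
    toReal_tsum_laceSum_mul_etau hχ] at h
  exact h

lemma toReal_remSum_add {p : unitInterval} (hχ : ∑' y : Site d, etau p y ≠ ⊤) (n : ℕ)
    (x : Site d) : (remSum p n x).toReal + p * (remSum p (n + 1) x).toReal =
      (laceSum p (n + 1) x).toReal +
        p * ∑' y, (laceSum p (n + 1) y).toReal * tau p (x - y) := by
  have h := congrArg ENNReal.toReal (remSum_add_remSum hχ n x)
  rw [ENNReal.toReal_add (remSum_ne_top hχ n x)
      (ENNReal.mul_ne_top ENNReal.ofReal_ne_top (remSum_ne_top hχ (n + 1) x)),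
    ENNReal.toReal_add (laceSum_ne_top hχ (n + 1) x)
      (ENNReal.mul_ne_top ENNReal.ofReal_ne_top (tsum_laceSum_mul_etau_ne_top hχ (n + 1) x)),
    ENNReal.toReal_mul, ENNReal.toReal_mul, ENNReal.toReal_ofReal p.2.1,
    toReal_tsum_laceSum_mul_etau hχ] at h
  exact h

lemma tau_eq_sum {p : unitInterval} (hχ : ∑' y : Site d, etau p y ≠ ⊤) (n : ℕ) (x : Site d) :
    tau p x = ∑ m ∈ Finset.range (n + 1), (-(p : ℝ)) ^ m * ((laceSum p m x).toReal +
        p * ∑' y, (laceSum p m y).toReal * tau p (x - y)) +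
      (-(p : ℝ)) ^ (n + 1) * (remSum p n x).toReal := by
  induction n with
  | zero =>
    have := tau_add_remSum hχ x
    simp only [zero_add, Finset.sum_range_one, pow_zero, one_mul, pow_one]
    linarith
  | succ n ih =>
    rw [Finset.sum_range_succ, ih, ← toReal_remSum_add hχ n x]
    ring

end SitePercolation

end

theorem proposition2 (d : ℕ) (hd : 1 ≤ d) (p : unitInterval) (hp : (p : ℝ) < SitePercolation.pc d)
    (x : SitePercolation.Site d) (n : ℕ) :
    -- the series that define the coefficients, the remainder and the convolution converge
    (∀ m : ℕ, 1 ≤ m → m ≤ n → ∀ y : SitePercolation.Site d,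
      Summable fun u : Fin m → SitePercolation.Site d =>
        (SitePercolation.percSeq d p).real
          (SitePercolation.laceEvent m (SitePercolation.vertexSeq u y))) ∧
    (Summable fun u : Fin (n + 1) → SitePercolation.Site d =>
      (SitePercolation.percSeq d p).real
        (SitePercolation.remainderEvent n (SitePercolation.vertexSeq u x))) ∧
    (Summable fun y : SitePercolation.Site d =>
      (SitePercolation.J y + SitePercolation.PiSum p n y) * SitePercolation.tau p (x - y)) ∧
    -- the lace expansion
    SitePercolation.tau p x =
      SitePercolation.J x + SitePercolation.PiSum p n x
        + (p : ℝ) * SitePercolation.conv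
            (SitePercolation.J + SitePercolation.PiSum p n) (SitePercolation.tau p) x
        + SitePercolation.remainder p n x := by
  open SitePercolation in
  have hχ := tsum_etau_ne_top_of_lt_pc hp
  have hs : ∀ m ∈ Finset.range (n + 1), Summable fun y =>
      (-(p : ℝ)) ^ m * ((laceSum p m y).toReal * tau p (x - y)) := fun m _ =>
    (summable_laceSum_mul_tau hχ m x).mul_left _
  have hterm : ∀ y, (J y + PiSum p n y) * tau p (x - y) = ∑ m ∈ Finset.range (n + 1),
      (-(p : ℝ)) ^ m * ((laceSum p m y).toReal * tau p (x - y)) := fun y => by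
    rw [J_add_PiSum, Finset.sum_mul]
    exact Finset.sum_congr rfl fun m _ => mul_assoc _ _ _
  refine ⟨fun m _ _ y => ENNReal.summable_toReal (laceSum_ne_top hχ m y),
    ENNReal.summable_toReal (remSum_ne_top hχ n x), ?_, ?_⟩
  · simp only [hterm]
    exact summable_sum hs
  · have hconv : conv (J + PiSum p n) (tau p) x = ∑ m ∈ Finset.range (n + 1),
        (-(p : ℝ)) ^ m * ∑' y, (laceSum p m y).toReal * tau p (x - y) := by
      simp only [conv, Pi.add_apply, hterm]
      rw [Summable.tsum_finsetSum hs]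
      exact Finset.sum_congr rfl fun m _ => tsum_mul_left
    have hrem : remainder p n x = (-(p : ℝ)) ^ (n + 1) * (remSum p n x).toReal := by
      rw [remainder, remSum, ENNReal.tsum_toReal_eq fun u => measure_ne_top _ _]
      rfl
    rw [hconv, hrem, J_add_PiSum, tau_eq_sum hχ n x, Finset.mul_sum, ← Finset.sum_add_distrib]
    congr 1
    exact Finset.sum_congr rfl fun m _ => by ring
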